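/- Let $K\ge 0$ and $r_0,r_1\ge 1$ be integers. Consider the Kronecker quiver with two vertices $0,1$ and $K$ arrows $0\to 1$, with dimension vector $(r_0,r_1)$. Its representation space is $V=\mathrm{Mat}(r_1\times r_0,\mathbb{C})^{\oplus K}$, with coordinate ring $\mathbb{C}[V]=\mathbb{C}[x^i_{jk} : 1\le i\le K,\ 1\le j\le r_1,\ 1\le k\le r_0]$, where $x^i_{jk}$ is the $(j,k)$ entry of the $i$-th matrix. The group $G=GL(r_0)\times GL(r_1)$ acts on $V$ by $(g\cdot M)_i=g_1M_ig_0^{-1}$ and on $\mathbb{C}[V]$ by $(g\cdot f)(M)=f(g^{-1}\cdot M)$. A semi-invariant of weight $(\alpha_0,\alpha_1)\in\mathbb{Z}^2$ is an $f\in\mathbb{C}[V]$ with $g\cdot f=\det(g_0)^{\alpha_0}\det(g_1)^{\alpha_1}f$ for all $g\in G$, and the semi-invariant ring is the sum in $\mathbb{C}[V]$ of the spaces of semi-invariants of all weights. A linked pair of tableaux $T^\pm=(T^-,T^+,\sigma)$ consists of integers $w^-,w^+\ge 0$; a tableau $T^-$ with $r_0$ rows and $w^-$ columns, filled with labels $(i,j)\in\{1,\dots,K\}\times\{1,\dots,r_1\}$;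 a tableau $T^+$ with $r_1$ rows and $w^+$ columns, filled with labels $(i,k)\in\{1,\dots,K\}\times\{1,\dots,r_0\}$; and a bijection $\sigma$ (the link) from the boxes of $T^+$ to the boxes of $T^-$ that takes every box in row $j$ of $T^+$ with label $(i,k)$ to a box in row $k$ of $T^-$ with label $(i,j)$. The linked pair is semi-standard if, for the lexicographic order of labels, both tableaux are weakly increasing along rows and strictly increasing along columns, and the link is semi-standard, i.e. on the boxes of any one row of $T^+$ that carry the same label $\sigma$ preserves the left-to-right order. The group $\mathrm{Sym}_{r_1}^{w^+}$ acts on linked pairs by permuting the labels within each column of $T^+$ and, correspondingly, the second entries of the labels in the boxes of $T^-$ linked to that column; $\mathrm{Sym}_{r_0}^{w^-}$ acts likewise by permuting the labels within each column of $T^-$ and the second entries of the labels in the boxes of $T^+$ linked to that column. Let $\mathrm{Mon}(T^+)=\prod x^i_{jk}$, the product over all boxes of $T^+$, where $j$ is the row of the box and $(i,k)$ its label, and put $$f_{T^\pm}=\sum_{\alpha^-\in \mathrm{Sym}_{r_0}^{w^-}}\ \sum_{\alpha^+\in \mathrm{Sym}_{r_1}^{w^+}}\mathrm{sign}(\alpha^-)\,\mathrm{sign}(\alpha^+)\,\mathrm{Mon}(\alpha^-\cdot\alpha^+\cdot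 T^+),$$ where the sign of a tuple of permutations is the product of their signs. Then the polynomials $f_{T^\pm}$, where $T^\pm$ runs over all semi-standard linked pairs (of all sizes $w^\pm$), lie in the semi-invariant ring and form a basis of it as a complex vector space (in particular they are pairwise distinct). -/

import Mathlib

noncomputable section

namespace KroneckerQuiver

/-! ### The semi-invariant ring of the Kronecker quiver

A representation of dimension vector `(r₀, r₁)` of the quiver with two vertices `0`, `1` and `K`
arrows `0 → 1` is a `K`-tuple of complex `r₁ × r₀` matrices. -/

/-- The coordinate ring of the representation space. The variable `X (i, j, k)` is the coordinate
`x^i_{jk}`, the `(j, k)` entry of the `i`-th matrix. -/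
abbrev CoordRing (K r₀ r₁ : ℕ) : Type := MvPolynomial (Fin K × Fin r₁ × Fin r₀) ℂ

/-- The group `GL(r₀) × GL(r₁)`, acting on representations by `(g · M)_i = g₁ M_i g₀⁻¹`. -/
abbrev GLGroup (r₀ r₁ : ℕ) : Type :=
  Matrix.GeneralLinearGroup (Fin r₀) ℂ × Matrix.GeneralLinearGroup (Fin r₁) ℂ

/-- The matrix of coordinates of the `i`-th arrow. -/
def coordMatrix (K r₀ r₁ : ℕ) (i : Fin K) : Matrix (Fin r₁) (Fin r₀) (CoordRing K r₀ r₁) :=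
  fun j k => MvPolynomial.X (i, j, k)

/-- A complex matrix, regarded as a matrix of constant polynomials. -/
def constMatrix (K r₀ r₁ : ℕ) {n : ℕ} (A : Matrix (Fin n) (Fin n) ℂ) :
    Matrix (Fin n) (Fin n) (CoordRing K r₀ r₁) :=
  fun j k => MvPolynomial.C (A j k)

/-- The action of `g` on polynomials, `(g · f)(M) = f (g⁻¹ · M)`: every matrix of coordinates `M_i`
is replaced by `g₁⁻¹ M_i g₀`. -/
def act (K : ℕ) {r₀ r₁ : ℕ} (g : GLGroup r₀ r₁) : CoordRing K r₀ r₁ →ₐ[ℂ] CoordRing K r₀ r₁ :=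
  MvPolynomial.aeval fun x =>
    (constMatrix K r₀ r₁ (g.2⁻¹).val * coordMatrix K r₀ r₁ x.1 * constMatrix K r₀ r₁ g.1.val)
      x.2.1 x.2.2

/-- The character of `GL(r₀) × GL(r₁)` with weight `α = (α₀, α₁)`. -/
def character {r₀ r₁ : ℕ} (α : ℤ × ℤ) (g : GLGroup r₀ r₁) : ℂ :=
  g.1.val.det ^ α.1 * g.2.val.det ^ α.2

/-- The space of semi-invariants of weight `α`. -/
def semiInvariants (K r₀ r₁ : ℕ) (α : ℤ × ℤ) : Submodule ℂ (CoordRing K r₀ r₁) where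
  carrier := {f | ∀ g : GLGroup r₀ r₁, act K g f = character α g • f}
  zero_mem' := by intro g; simp
  add_mem' := by
    intro f h hf hh g
    rw [map_add, hf g, hh g, smul_add]
  smul_mem' := by
    intro c f hf g
    rw [map_smul, hf g, smul_comm]

theorem one_mem_semiInvariants (K r₀ r₁ : ℕ) :
    (1 : CoordRing K r₀ r₁) ∈ semiInvariants K r₀ r₁ 0 := by
  intro g
  simp [character]

theorem character_add {r₀ r₁ : ℕ} (α β : ℤ × ℤ) (g : GLGroup r₀ r₁) :
    character (α + β) g = character α g * character β g := by
  have h0 : g.1.val.det ≠ 0 := (Matrix.isUnit_iff_isUnit_det _).1 g.1.isUnit |>.ne_zero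
  have h1 : g.2.val.det ≠ 0 := (Matrix.isUnit_iff_isUnit_det _).1 g.2.isUnit |>.ne_zero
  simp only [character, Prod.fst_add, Prod.snd_add, zpow_add₀ h0, zpow_add₀ h1]
  ring

theorem mul_mem_semiInvariants {K r₀ r₁ : ℕ} {α β : ℤ × ℤ} {f h : CoordRing K r₀ r₁}
    (hf : f ∈ semiInvariants K r₀ r₁ α) (hh : h ∈ semiInvariants K r₀ r₁ β) :
    f * h ∈ semiInvariants K r₀ r₁ (α + β) := by
  intro g
  rw [map_mul, hf g, hh g, character_add, smul_mul_smul_comm]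

/-- The ring of semi-invariants: the sum of the spaces of semi-invariants of all weights. -/
def semiInvariantRing (K r₀ r₁ : ℕ) : Subalgebra ℂ (CoordRing K r₀ r₁) :=
  (⨆ α, semiInvariants K r₀ r₁ α).toSubalgebra
    (Submodule.mem_iSup_of_mem 0 (one_mem_semiInvariants K r₀ r₁))
    (by
      intro f h hf hh
      induction hf using Submodule.iSup_induction' with
      | mem α f hf =>
        induction hh using Submodule.iSup_induction' with
        | mem β h hh => exact Submodule.mem_iSup_of_mem (α + β) (mul_mem_semiInvariants hf hh)
        | zero => simp
        | add x y _ _ hx hy => rw [mul_add]; exact add_mem hx hy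
      | zero => simp
      | add x y _ _ hx hy => rw [add_mul]; exact add_mem hx hy)

/-! ### Linked tableaux pairs -/

/-- A linked pair of tableaux. `tMinus` has `r₀` rows and `wMinus` columns, `tPlus` has `r₁` rows and
`wPlus` columns; `tPlus j c` is the label in row `j` and column `c`, and a label `(i, k)` consists of
an arrow `i` and an index `k`. The link takes a box in row `j` of `tPlus` with label `(i, k)` to a
box in row `k` of `tMinus` with label `(i, j)`. -/
structure LinkedPair (K r₀ r₁ : ℕ) where
  wMinus : ℕ
  wPlus : ℕ
  tMinus : Fin r₀ → Fin wMinus → Fin K × Fin r₁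
  tPlus : Fin r₁ → Fin wPlus → Fin K × Fin r₀
  link : Fin r₁ × Fin wPlus ≃ Fin r₀ × Fin wMinus
  link_arrow : ∀ B, (tMinus (link B).1 (link B).2).1 = (tPlus B.1 B.2).1
  link_row_minus : ∀ B, (link B).1 = (tPlus B.1 B.2).2
  link_row_plus : ∀ B, (tMinus (link B).1 (link B).2).2 = B.1

/-- A rectangular tableau is semi-standard if it is weakly increasing along rows and strictly
increasing along columns; labels are ordered lexicographically. -/
def IsSemiStandardTableau {K r s w : ℕ} (t : Fin r → Fin w → Fin K × Fin s) : Prop :=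
  (∀ j, Monotone fun c => toLex (t j c)) ∧ (∀ c, StrictMono fun j => toLex (t j c))

namespace LinkedPair

variable {K r₀ r₁ : ℕ}

/-- The link is semi-standard: on the boxes of a fixed row of `tPlus` that carry a fixed label
(which are linked to boxes in one row of `tMinus`) it preserves the left-to-right order. -/
def IsSemiStandardLink (T : LinkedPair K r₀ r₁) : Prop :=
  ∀ (j : Fin r₁) (c c' : Fin T.wPlus), T.tPlus j c = T.tPlus j c' → c < c' →
    (T.link (j, c)).2 < (T.link (j, c')).2

/-- A linked pair is semi-standard if both tableaux and the link are. -/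
def IsSemiStandard (T : LinkedPair K r₀ r₁) : Prop :=
  IsSemiStandardTableau T.tMinus ∧ IsSemiStandardTableau T.tPlus ∧ T.IsSemiStandardLink

/-- `α⁺` acts on a linked pair: its `c`-th component permutes the labels within the `c`-th column of
`tPlus` (the label in row `j` moves to row `α⁺ c j`), and correspondingly the second entries of the
labels of the boxes of `tMinus` that are linked to this column. -/
def actPlus (T : LinkedPair K r₀ r₁) (a : Fin T.wPlus → Equiv.Perm (Fin r₁)) :
    LinkedPair K r₀ r₁ where
  wMinus := T.wMinus
  wPlus := T.wPlus
  tMinus k d :=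
    ((T.tMinus k d).1, a (T.link.symm (k, d)).2 (T.tMinus k d).2)
  tPlus j c := T.tPlus ((a c)⁻¹ j) c
  link :=
    { toFun := fun B => T.link ((a B.2)⁻¹ B.1, B.2)
      invFun := fun B => (a (T.link.symm B).2 (T.link.symm B).1, (T.link.symm B).2)
      left_inv := fun B => by simp
      right_inv := fun B => by simp }
  link_arrow B := T.link_arrow ((a B.2)⁻¹ B.1, B.2)
  link_row_minus B := T.link_row_minus ((a B.2)⁻¹ B.1, B.2)
  link_row_plus B := by
    have h := T.link_row_plus ((a B.2)⁻¹ B.1, B.2)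
    simp only [Equiv.coe_fn_mk, Prod.mk.eta, Equiv.symm_apply_apply] at h ⊢
    rw [h]
    simp

/-- `α⁻` acts on a linked pair: its `d`-th component permutes the labels within the `d`-th column of
`tMinus`, and correspondingly the second entries of the labels of the boxes of `tPlus` that are
linked to this column. -/
def actMinus (T : LinkedPair K r₀ r₁) (a : Fin T.wMinus → Equiv.Perm (Fin r₀)) :
    LinkedPair K r₀ r₁ where
  wMinus := T.wMinus
  wPlus := T.wPlus
  tMinus k d := T.tMinus ((a d)⁻¹ k) d
  tPlus j c := ((T.tPlus j c).1, a (T.link (j, c)).2 (T.tPlus j c).2)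
  link :=
    { toFun := fun B => (a (T.link B).2 (T.link B).1, (T.link B).2)
      invFun := fun B => T.link.symm ((a B.2)⁻¹ B.1, B.2)
      left_inv := fun B => by simp
      right_inv := fun B => by simp }
  link_arrow B := by simpa using T.link_arrow B
  link_row_minus B := by
    have h := T.link_row_minus B
    simp only [Equiv.coe_fn_mk, Prod.mk.eta] at h ⊢
    rw [h]
  link_row_plus B := by simpa using T.link_row_plus B

/-- The monomial of `tPlus`: a box in row `j` with label `(i, k)` contributes `x^i_{jk}`. -/
def mon (T : LinkedPair K r₀ r₁) : CoordRing K r₀ r₁ :=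
  ∏ j, ∏ c, MvPolynomial.X ((T.tPlus j c).1, j, (T.tPlus j c).2)

/-- The polynomial `f_{T^±}`, the signed sum of the monomials of `α⁻ · α⁺ · T` over all
`α⁺ ∈ Sym(r₁)^{w⁺}` and `α⁻ ∈ Sym(r₀)^{w⁻}`. -/
def semiInvariant (T : LinkedPair K r₀ r₁) : CoordRing K r₀ r₁ :=
  ∑ am : Fin T.wMinus → Equiv.Perm (Fin r₀), ∑ ap : Fin T.wPlus → Equiv.Perm (Fin r₁),
    ((∏ d, (Equiv.Perm.sign (am d) : ℤ)) * ∏ c, (Equiv.Perm.sign (ap c) : ℤ)) •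
      ((T.actPlus ap).actMinus am).mon

end LinkedPair

end KroneckerQuiver

end

/-! The theorem is proved by matching leading monomials, for a lexicographic order, with
semi-standard linked pairs.

A semi-invariant of the quiver is a determinantal semi-invariant of GL(r₁) acting on the block
matrix (M₁ | M₂ | ⋯), and of GL(r₀) acting on (M₁ᵀ | M₂ᵀ | ⋯). On each side, straightening by Garnir
relations writes a power of one minor times the semi-invariant as a combination of standard products
of maximal minors. The order is chosen so that the diagonal term of every minor leads; hence the
leading monomial is that of a standard tableau (`IsDetSemiInvariant.exists_degree_eq`). The tableaux
obtained from the two sides share this monomial, so their boxes can be linked, and in exactly one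
semi-standard way (`exists_of_labelDegree_eq`, `IsSemiStandard.eq_of_labelDegree_eq`).

Conversely, f_T has leading monomial Mon(T⁺). Regard boxes as edges of a bipartite graph whose
vertices are the columns of T⁺ and T⁻. A cut argument (`IsRelabelling.exists_of_agree_lt`) shows
that no column permutations produce a larger monomial. Permutations that reproduce Mon(T⁺) do so
with sign +1: by the equality case of the rearrangement inequality, the two families are the same
permutation of the boxes (`IsRelabelling.perm_eq_of_labelDegree_eq`). So nothing cancels at the top.

Thus the f_T have pairwise distinct leading monomials, which gives independence, and these are all
the leading monomials of semi-invariants, which gives spanning by descent. -/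

noncomputable section

namespace KroneckerQuiver

/-! ### The monomial order -/

/-- The variables `x^i_{jk}`, ordered lexicographically by `(i, j, k)`. -/
def lexVar (K r₀ r₁ : ℕ) : Fin K × Fin r₁ × Fin r₀ ≃ Fin K ×ₗ (Fin r₁ ×ₗ Fin r₀) :=
  (Equiv.prodCongr (Equiv.refl _) toLex).trans toLex

/-- The lexicographic monomial order with `x^i_{jk}` larger than `x^{i'}_{j'k'}` when
`(i, j, k)` is lexicographically smaller than `(i', j', k')`. -/
def lexMonomialOrder (K r₀ r₁ : ℕ) : MonomialOrder (Fin K × Fin r₁ × Fin r₀) where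
  syn := Lex ((Fin K ×ₗ (Fin r₁ ×ₗ Fin r₀)) →₀ ℕ)
  toSyn := (Finsupp.domCongr (lexVar K r₀ r₁)).trans MonomialOrder.lex.toSyn
  toSyn_monotone := fun a b h => MonomialOrder.lex.toSyn_monotone
    (show Finsupp.equivMapDomain _ a ≤ Finsupp.equivMapDomain _ b from fun x => by
      simpa [Finsupp.equivMapDomain_apply] using h _)

theorem lexMonomialOrder_lt_iff {K r₀ r₁ : ℕ} {a b : Fin K × Fin r₁ × Fin r₀ →₀ ℕ} :
    (lexMonomialOrder K r₀ r₁).toSyn a < (lexMonomialOrder K r₀ r₁).toSyn b ↔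
      ∃ x, (∀ y, lexVar K r₀ r₁ y < lexVar K r₀ r₁ x → a y = b y) ∧ a x < b x := by
  change (∃ x : Fin K ×ₗ (Fin r₁ ×ₗ Fin r₀), (∀ y : Fin K ×ₗ (Fin r₁ ×ₗ Fin r₀), y < x →
    a ((lexVar K r₀ r₁).symm y) = b ((lexVar K r₀ r₁).symm y)) ∧
    a ((lexVar K r₀ r₁).symm x) < b ((lexVar K r₀ r₁).symm x)) ↔ _
  rw [(lexVar K r₀ r₁).symm.exists_congr_left]
  refine exists_congr fun x => ?_
  rw [(lexVar K r₀ r₁).symm.forall_congr_left]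
  simp

theorem lexVar_lt_iff {K r₀ r₁ : ℕ} {x y : Fin K × Fin r₁ × Fin r₀} :
    lexVar K r₀ r₁ x < lexVar K r₀ r₁ y ↔
      x.1 < y.1 ∨ x.1 = y.1 ∧ (x.2.1 < y.2.1 ∨ x.2.1 = y.2.1 ∧ x.2.2 < y.2.2) := by
  change toLex (x.1, toLex x.2) < toLex (y.1, toLex y.2) ↔ _
  simp [Prod.Lex.toLex_lt_toLex]

/-- A monomial is lexicographically smaller than another one if every variable in which it is
larger is preceded by one in which it is smaller. -/
theorem lexMonomialOrder_lt_of_forall_exists {K r₀ r₁ : ℕ} {a b : Fin K × Fin r₁ × Fin r₀ →₀ ℕ}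
    (hne : a ≠ b)
    (h : ∀ y, b y < a y → ∃ z, lexVar K r₀ r₁ z < lexVar K r₀ r₁ y ∧ a z < b z) :
    (lexMonomialOrder K r₀ r₁).toSyn a < (lexMonomialOrder K r₀ r₁).toSyn b := by
  by_contra hlt
  rcases (not_lt.1 hlt).lt_or_eq with hlt | heq
  · obtain ⟨x, hx, hxlt⟩ := lexMonomialOrder_lt_iff.1 hlt
    obtain ⟨z, hz, hzlt⟩ := h x hxlt
    exact hzlt.ne' (hx z hz)
  · exact hne ((lexMonomialOrder K r₀ r₁).toSyn.injective heq.symm)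

/-! ### Products of maximal minors of a generic matrix -/

section Minors

open MvPolynomial

variable {r N : ℕ} {σ : Type*} (v : Fin r × Fin N ≃ σ)

/-- The maximal minor of the generic `r × N` matrix with entries `X (v (j, q))` in the columns
`s 0, s 1, …`. -/
def minor (s : Fin r → Fin N) : MvPolynomial σ ℂ :=
  (Matrix.of fun a b => (X (v (a, s b)) : MvPolynomial σ ℂ)).det

/-- The product of the maximal minors given by the columns of a tableau. -/
def minorProd {w : ℕ} (s : Fin r × Fin w → Fin N) : MvPolynomial σ ℂ :=
  ∏ c, minor v fun j => s (j, c)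

theorem minor_comp_perm (s : Fin r → Fin N) (π : Equiv.Perm (Fin r)) :
    minor v (s ∘ π) = (Equiv.Perm.sign π : ℤ) • minor v s := by
  have := Matrix.det_permute' π (Matrix.of fun a b => (X (v (a, s b)) : MvPolynomial σ ℂ))
  rw [zsmul_eq_mul]
  exact this

theorem minor_eq_zero_of_not_injective {s : Fin r → Fin N} (h : ¬ Function.Injective s) :
    minor v s = 0 := by
  simp only [Function.Injective, not_forall] at h
  obtain ⟨a, b, hab, hne⟩ := h
  exact Matrix.det_zero_of_column_eq hne fun i => by simp [hab]

theorem prod_det_eq_sum {R : Type*} [CommRing R] {r w : ℕ}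
    (M : Fin w → Matrix (Fin r) (Fin r) R) :
    ∏ c, (M c).det = ∑ τ : Fin w → Equiv.Perm (Fin r),
      (∏ c, (Equiv.Perm.sign (τ c) : ℤ)) • ∏ b : Fin r × Fin w, M b.2 (τ b.2 b.1) b.1 := by
  simp_rw [Matrix.det_apply, Fintype.prod_sum]
  refine Finset.sum_congr rfl fun τ _ => ?_
  simp_rw [Units.smul_def, zsmul_eq_mul]
  rw [Finset.prod_mul_distrib, Fintype.prod_prod_type_right]
  push_cast
  rfl

theorem minorProd_eq_sum {w : ℕ} (s : Fin r × Fin w → Fin N) :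
    minorProd v s = ∑ τ : Fin w → Equiv.Perm (Fin r),
      (∏ c, (Equiv.Perm.sign (τ c) : ℤ)) • ∏ b, X (v (τ b.2 b.1, s b)) :=
  prod_det_eq_sum _

theorem minorProd_comp_prodCongrLeft {w : ℕ} (s : Fin r × Fin w → Fin N)
    (τ : Fin w → Equiv.Perm (Fin r)) :
    minorProd v (s ∘ Equiv.prodCongrLeft τ) =
      (Equiv.Perm.sign (Equiv.prodCongrLeft τ) : ℤ) • minorProd v s := by
  rw [Equiv.Perm.sign_prodCongrLeft, minorProd, minorProd, zsmul_eq_mul]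
  push_cast
  rw [← Finset.prod_mul_distrib]
  refine Finset.prod_congr rfl fun c _ => ?_
  rw [← zsmul_eq_mul]
  exact minor_comp_perm v (fun j => s (j, c)) (τ c)

/-- A permutation of the boxes that preserves all columns is a family of permutations of the
columns. -/
theorem exists_prodCongrLeft_eq {w : ℕ} (π : Equiv.Perm (Fin r × Fin w))
    (h : ∀ b, (π b).2 = b.2) : ∃ τ : Fin w → Equiv.Perm (Fin r), π = Equiv.prodCongrLeft τ := by
  have hinj (c : Fin w) : Function.Injective fun j => (π (j, c)).1 := fun a b hab =>
    congrArg Prod.fst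
      (π.injective (Prod.ext hab ((h (a, c)).trans (h (b, c)).symm)) : (a, c) = (b, c))
  refine ⟨fun c => Equiv.ofBijective _ (Finite.injective_iff_bijective.1 (hinj c)), ?_⟩
  ext1 b
  exact Prod.ext rfl (h b)

/-- The Garnir relation: antisymmetrizing over more than `r` boxes gives zero. -/
theorem garnir_relation {w : ℕ} (s : Fin r × Fin w → Fin N) (A : Fin r × Fin w → Prop)
    [DecidablePred A] (hA : r < Fintype.card {b // A b}) :
    ∑ π : Equiv.Perm {b // A b},
      (Equiv.Perm.sign π : ℤ) • minorProd v (s ∘ Equiv.Perm.ofSubtype π) = 0 := by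
  -- Expand all minors by Leibniz and fix the row assignment `τ`. The sum over `π` is then, up to a
  -- common factor, a determinant indexed by the boxes in `A`; by pigeonhole two of these boxes lie
  -- in the same matrix row, so two columns agree.
  simp_rw [minorProd_eq_sum, Finset.smul_sum]
  rw [Finset.sum_comm]
  refine Finset.sum_eq_zero fun τ _ => ?_
  obtain ⟨b₁, b₂, hne, heq⟩ := Fintype.exists_ne_map_eq_of_card_lt
    (fun b : {b // A b} => τ b.1.2 b.1.1) (by simpa using hA)
  have hdet : (Matrix.of fun a b : {b // A b} =>
      (X (v (τ b.1.2 b.1.1, s a)) : MvPolynomial σ ℂ)).det = 0 :=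
    Matrix.det_zero_of_column_eq hne fun i => by simp only [Matrix.of_apply]; rw [heq]
  rw [Matrix.det_apply] at hdet
  simp_rw [smul_comm (_ : ℤ) (∏ c, (Equiv.Perm.sign (τ c) : ℤ)), ← Finset.smul_sum]
  have key (π : Equiv.Perm {b // A b}) :
      ∏ b, (X (v (τ b.2 b.1, (s ∘ Equiv.Perm.ofSubtype π) b)) : MvPolynomial σ ℂ) =
        (∏ b : {b // A b}, X (v (τ b.1.2 b.1.1, s (π b)))) *
          ∏ b : {b // ¬ A b}, X (v (τ b.1.2 b.1.1, s b)) := by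
    rw [← Fintype.prod_subtype_mul_prod_subtype A]
    congr 1
    · exact Finset.prod_congr rfl fun b _ => by
        rw [Function.comp_apply, Equiv.Perm.ofSubtype_apply_coe]
    · exact Finset.prod_congr rfl fun b _ => by
        rw [Function.comp_apply, Equiv.Perm.ofSubtype_apply_of_not_mem _ b.2]
  simp_rw [key, ← smul_mul_assoc]
  rw [← Finset.sum_mul]
  simp only [Units.smul_def, Matrix.of_apply] at hdet
  rw [hdet, zero_mul, smul_zero]

/-- A rectangular tableau with entries in `Fin N` that is weakly increasing along rows and strictly
increasing along columns. -/
def IsStandard {w : ℕ} (s : Fin r × Fin w → Fin N) : Prop :=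
  (∀ j, Monotone fun c => s (j, c)) ∧ ∀ c, StrictMono fun j => s (j, c)

/-- The span of the products of `w` maximal minors that correspond to standard tableaux. -/
def standardSpan (w : ℕ) : Submodule ℂ (MvPolynomial σ ℂ) :=
  Submodule.span ℂ (Set.range fun s : {s : Fin r × Fin w → Fin N // IsStandard s} =>
    minorProd v s.1)

/-- The weight that increases when larger entries are moved to the right. -/
def columnWeight {w : ℕ} (s : Fin r × Fin w → Fin N) : ℕ := ∑ b, (b.2 : ℕ) * s b

theorem columnWeight_le {w : ℕ} (s : Fin r × Fin w → Fin N) :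
    columnWeight s ≤ ∑ b : Fin r × Fin w, (b.2 : ℕ) * N :=
  Finset.sum_le_sum fun b _ => Nat.mul_le_mul_left _ (s b).2.le

theorem columnWeight_comp_prodCongrLeft {w : ℕ} (s : Fin r × Fin w → Fin N)
    (τ : Fin w → Equiv.Perm (Fin r)) :
    columnWeight (s ∘ Equiv.prodCongrLeft τ) = columnWeight s :=
  Fintype.sum_equiv (Equiv.prodCongrLeft τ) _ _ fun b => by simp

/-- Exchanging entries between columns `c < c'`, where the entries in column `c` are larger than
`θ` and those in column `c'` smaller, increases the weight. -/
theorem columnWeight_lt_comp {w : ℕ} (s : Fin r × Fin w → Fin N) (A : Fin r × Fin w → Prop)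
    [DecidablePred A] {c c' : Fin w} (hcc : c < c') (θ : ℤ)
    (hA : ∀ b, A b → b.2 = c ∧ θ < 2 * (s b : ℤ) ∨ b.2 = c' ∧ 2 * (s b : ℤ) < θ)
    (π : Equiv.Perm {b // A b}) (hπ : ∃ b, (π b).1.2 ≠ b.1.2) :
    columnWeight s < columnWeight (s ∘ Equiv.Perm.ofSubtype π) := by
  have h1 : (columnWeight (s ∘ Equiv.Perm.ofSubtype π) : ℤ) - columnWeight s =
      ∑ b : {b // A b}, ((b.1.2 : ℤ) - (π b).1.2) * s (π b) := by
    unfold columnWeight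
    push_cast
    rw [← Fintype.sum_subtype_add_sum_subtype A (fun b : Fin r × Fin w => (b.2 : ℤ) * (s b : ℤ)),
      ← Fintype.sum_subtype_add_sum_subtype A
        (fun b : Fin r × Fin w => (b.2 : ℤ) * ((s ∘ Equiv.Perm.ofSubtype π) b : ℤ))]
    have h2 : ∑ b : {b // ¬ A b}, (b.1.2 : ℤ) * ((s ∘ Equiv.Perm.ofSubtype π) b : ℤ) =
        ∑ b : {b // ¬ A b}, (b.1.2 : ℤ) * (s b : ℤ) :=
      Finset.sum_congr rfl fun b _ => by
        rw [Function.comp_apply, Equiv.Perm.ofSubtype_apply_of_not_mem _ b.2]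
    have h3 : ∑ b : {b // A b}, (b.1.2 : ℤ) * (s b : ℤ) =
        ∑ b : {b // A b}, ((π b).1.2 : ℤ) * (s (π b) : ℤ) :=
      (Equiv.sum_comp π fun b : {b // A b} => (b.1.2 : ℤ) * (s b : ℤ)).symm
    rw [h2, h3, add_sub_add_right_eq_sub, ← Finset.sum_sub_distrib]
    exact Finset.sum_congr rfl fun b _ => by
      rw [Function.comp_apply, Equiv.Perm.ofSubtype_apply_coe]; ring
  -- The column differences sum to zero, so the threshold `θ` can be subtracted from all entries for
  -- free.
  have h4 : ∑ b : {b // A b}, ((b.1.2 : ℤ) - (π b).1.2) = 0 := by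
    rw [Finset.sum_sub_distrib, sub_eq_zero]
    exact (Equiv.sum_comp π fun b : {b // A b} => (b.1.2 : ℤ)).symm
  have h5 : 2 * ∑ b : {b // A b}, ((b.1.2 : ℤ) - (π b).1.2) * s (π b) =
      ∑ b : {b // A b}, ((b.1.2 : ℤ) - (π b).1.2) * (2 * s (π b) - θ) := by
    rw [← sub_zero (2 * _), ← zero_mul θ, ← h4, Finset.mul_sum, Finset.sum_mul,
      ← Finset.sum_sub_distrib]
    exact Finset.sum_congr rfl fun b _ => by ring
  have hcc' : (c : ℤ) < c' := by exact_mod_cast hcc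
  -- When `π` changes the column, both factors have the same sign: an entry below `θ` moves
  -- left-to-right from `c'` never, only back to `c`, where `c - c'` is negative, and symmetrically
  -- for large entries.
  have hpos (b : {b // A b}) : 0 ≤ ((b.1.2 : ℤ) - (π b).1.2) * (2 * s (π b) - θ) ∧
      ((π b).1.2 ≠ b.1.2 → 0 < ((b.1.2 : ℤ) - (π b).1.2) * (2 * s (π b) - θ)) := by
    rcases hA _ b.2 with ⟨h, -⟩ | ⟨h, -⟩ <;> rcases hA _ (π b).2 with ⟨h', h''⟩ | ⟨h', h''⟩ <;>
      rw [h, h']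
    · simp
    · have : 0 < ((c : ℤ) - c') * (2 * s (π b) - θ) := by nlinarith
      exact ⟨this.le, fun _ => this⟩
    · have : 0 < ((c' : ℤ) - c) * (2 * s (π b) - θ) := by nlinarith
      exact ⟨this.le, fun _ => this⟩
    · simp
  obtain ⟨b, hb⟩ := hπ
  have h6 := Finset.sum_pos' (fun b _ => (hpos b).1) ⟨b, Finset.mem_univ _, (hpos b).2 hb⟩
  omega

/-- The straightening step. At a descent in row `j`, the Garnir relation expresses a positive
multiple of the given product through tableaux of larger weight; the multiple can be divided out in
characteristic zero. -/
theorem minorProd_mem_standardSpan_of_strictMono {w : ℕ} (s : Fin r × Fin w → Fin N)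
    (hs : ∀ c, StrictMono fun j => s (j, c))
    (ih : ∀ s' : Fin r × Fin w → Fin N, columnWeight s < columnWeight s' →
      minorProd v s' ∈ standardSpan v w) :
    minorProd v s ∈ standardSpan v w := by
  by_cases hmono : ∀ j, Monotone fun c => s (j, c)
  · exact Submodule.subset_span ⟨⟨s, hmono, hs⟩, rfl⟩
  simp only [Monotone, not_forall, not_le] at hmono
  obtain ⟨j, c, c', hle, hlt⟩ := hmono
  have hcc : c < c' := hle.lt_of_ne (by rintro rfl; exact hlt.false)
  -- The Garnir boxes: column `c` from row `j` downwards and column `c'` down to row `j`. By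
  -- strictness of columns every entry of the first part exceeds every entry of the second.
  let A : Fin r × Fin w → Prop := fun b => b.2 = c ∧ j ≤ b.1 ∨ b.2 = c' ∧ b.1 ≤ j
  have hcard : r < Fintype.card {b // A b} := by
    -- Every row contributes a box, and row `j` contributes two, whence `r + 1` boxes; `none`
    -- accounts for the second one.
    let g : Option (Fin r) → {b // A b} := fun o => o.elim ⟨(j, c'), Or.inr ⟨rfl, le_rfl⟩⟩
      fun a => if h : j ≤ a then ⟨(a, c), Or.inl ⟨rfl, h⟩⟩ else
        ⟨(a, c'), Or.inr ⟨rfl, (not_le.1 h).le⟩⟩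
    have hg : Function.Injective g := by
      have hne := hcc.ne
      rintro (_ | a) (_ | b) hab
      · rfl
      · by_cases h : j ≤ b
        · simp [g, h, hne.symm] at hab
        · simp only [g, Option.elim, h, dite_false, Subtype.mk.injEq, Prod.mk.injEq] at hab
          exact absurd hab.1.le h
      · by_cases h : j ≤ a
        · simp [g, h, hne] at hab
        · simp only [g, Option.elim, h, dite_false, Subtype.mk.injEq, Prod.mk.injEq] at hab
          exact absurd hab.1.ge h
      · by_cases h : j ≤ a <;> by_cases h' : j ≤ b <;> simp [g, h, h', hne, hne.symm] at hab ⊢ <;>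
          exact hab
    simpa using Fintype.card_le_of_injective g hg
  have hrel := garnir_relation v s A hcard
  have hsep : ∀ b, A b → b.2 = c ∧ ((s (j, c) : ℤ) + s (j, c')) < 2 * (s b : ℤ) ∨
      b.2 = c' ∧ 2 * (s b : ℤ) < (s (j, c) : ℤ) + s (j, c') := by
    rintro ⟨a, d⟩ (⟨h0, h⟩ | ⟨h0, h⟩) <;> dsimp only at h0 h <;> subst h0
    · have h1 : s (j, d) ≤ s (a, d) := (hs d).monotone h
      left
      refine ⟨rfl, ?_⟩
      simp only [Fin.lt_def, Fin.le_def] at hlt h1 ⊢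
      omega
    · have h1 : s (a, d) ≤ s (j, d) := (hs d).monotone h
      right
      refine ⟨rfl, ?_⟩
      simp only [Fin.lt_def, Fin.le_def] at hlt h1 ⊢
      omega
  classical
  -- Permutations preserving the columns each reproduce the original product with sign +1; all
  -- others raise the weight.
  rw [← Finset.sum_filter_add_sum_filter_not _
    (fun π : Equiv.Perm {b // A b} => ∀ b, (π b).1.2 = b.1.2)] at hrel
  have hfix : ∀ π ∈ Finset.univ.filter
      (fun π : Equiv.Perm {b // A b} => ∀ b, (π b).1.2 = b.1.2),
      (Equiv.Perm.sign π : ℤ) • minorProd v (s ∘ Equiv.Perm.ofSubtype π) = minorProd v s := by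
    intro π hπ
    have hπ' : ∀ b, (Equiv.Perm.ofSubtype π b).2 = b.2 := fun b => by
      by_cases hb : A b
      · rw [Equiv.Perm.ofSubtype_apply_of_mem _ hb]
        exact (Finset.mem_filter.1 hπ).2 ⟨b, hb⟩
      · rw [Equiv.Perm.ofSubtype_apply_of_not_mem _ hb]
    obtain ⟨τ, hτ⟩ := exists_prodCongrLeft_eq _ hπ'
    rw [hτ, minorProd_comp_prodCongrLeft, ← hτ, Equiv.Perm.sign_ofSubtype, smul_smul,
      ← Units.val_mul, Int.units_mul_self, Units.val_one, one_smul]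
  rw [Finset.sum_congr rfl hfix, Finset.sum_const, ← eq_neg_iff_add_eq_zero] at hrel
  have hmem : (Finset.univ.filter
      (fun π : Equiv.Perm {b // A b} => ∀ b, (π b).1.2 = b.1.2)).card • minorProd v s ∈
      standardSpan v w := by
    rw [hrel]
    refine Submodule.neg_mem _ (Submodule.sum_mem _ fun π hπ => zsmul_mem (ih _ ?_) _)
    exact columnWeight_lt_comp s A hcc _ hsep π (by simpa using (Finset.mem_filter.1 hπ).2)
  rw [← Nat.cast_smul_eq_nsmul ℂ] at hmem
  refine (Submodule.smul_mem_iff _ ?_).1 hmem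
  rw [Nat.cast_ne_zero]
  exact Finset.card_ne_zero.2 ⟨1, by simp⟩

/-- Every product of maximal minors is a linear combination of standard ones. -/
theorem minorProd_mem_standardSpan {w : ℕ} (s : Fin r × Fin w → Fin N) :
    minorProd v s ∈ standardSpan v w := by
  -- Induction on the distance of the weight from its upper bound.
  induction hn : (∑ b : Fin r × Fin w, (b.2 : ℕ) * N) - columnWeight s using
    Nat.strong_induction_on generalizing s with
  | _ n ih =>
    by_cases hinj : ∀ c, Function.Injective fun j => s (j, c)
    · let τ : Fin w → Equiv.Perm (Fin r) := fun c => Tuple.sort fun j => s (j, c)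
      have hstrict : ∀ c, StrictMono fun j => (s ∘ Equiv.prodCongrLeft τ) (j, c) := fun c =>
        (Tuple.monotone_sort fun j => s (j, c)).strictMono_of_injective
          ((hinj c).comp (τ c).injective)
      have hmem := minorProd_mem_standardSpan_of_strictMono v _ hstrict fun s' hs' => by
        rw [columnWeight_comp_prodCongrLeft] at hs'
        have := columnWeight_le s'
        exact ih _ (by omega) s' rfl
      rw [minorProd_comp_prodCongrLeft] at hmem
      have := (standardSpan v w).smul_of_tower_mem
        (Equiv.Perm.sign (Equiv.prodCongrLeft τ) : ℤ) hmem
      rwa [smul_smul, ← Units.val_mul, Int.units_mul_self, Units.val_one, one_smul] at this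
    · simp only [not_forall] at hinj
      obtain ⟨c, hc⟩ := hinj
      rw [minorProd, Finset.prod_eq_zero (Finset.mem_univ c) (minor_eq_zero_of_not_injective v hc)]
      exact Submodule.zero_mem _

end Minors

/-! ### Leading monomials -/

section LeadingMonomials

open MvPolynomial

/-- A nontrivial linear combination of polynomials with distinct leading monomials has one of them
as its leading monomial. -/
theorem exists_degree_sum_eq {σ ι : Type*} (mo : MonomialOrder σ) (S : Finset ι)
    (g : ι → MvPolynomial σ ℂ) (a : ι → ℂ) (hg : ∀ i ∈ S, g i ≠ 0)
    (hinj : Set.InjOn (fun i => mo.degree (g i)) S) (ha : ∃ i ∈ S, a i ≠ 0) :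
    ∃ i ∈ S, mo.degree (∑ i ∈ S, a i • g i) = mo.degree (g i) ∧ ∑ i ∈ S, a i • g i ≠ 0 := by
  classical
  -- Among the terms with nonzero coefficient, the largest leading monomial belongs to one term
  -- only, so it survives.
  obtain ⟨i, hi, hmax⟩ := Finset.exists_max_image (S.filter fun i => a i ≠ 0)
    (fun i => mo.toSyn (mo.degree (g i)))
    (by obtain ⟨i, hi, hai⟩ := ha; exact ⟨i, Finset.mem_filter.2 ⟨hi, hai⟩⟩)
  rw [Finset.mem_filter] at hi
  have hcoeff : coeff (mo.degree (g i)) (∑ i ∈ S, a i • g i) = a i * mo.leadingCoeff (g i) := by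
    rw [coeff_sum, Finset.sum_eq_single_of_mem i hi.1, coeff_smul, smul_eq_mul]
    · rfl
    · intro b hb hbi
      rw [coeff_smul, smul_eq_mul]
      by_cases hab : a b = 0
      · rw [hab, zero_mul]
      · rw [mo.coeff_eq_zero_of_lt, mul_zero]
        exact (hmax b (Finset.mem_filter.2 ⟨hb, hab⟩)).lt_of_ne fun h =>
          hbi (hinj hb hi.1 (mo.toSyn.injective h))
  have hne : coeff (mo.degree (g i)) (∑ i ∈ S, a i • g i) ≠ 0 := by
    rw [hcoeff]
    exact mul_ne_zero hi.2 (mo.leadingCoeff_ne_zero_iff.2 (hg i hi.1))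
  refine ⟨i, hi.1, ?_, fun h => hne (by rw [h, coeff_zero])⟩
  apply mo.toSyn.injective
  refine le_antisymm (mo.degree_le_iff.2 fun b hb => ?_) (mo.le_degree (mem_support_iff.2 hne))
  rw [mem_support_iff, coeff_sum] at hb
  obtain ⟨j, hj, hbj⟩ := Finset.exists_ne_zero_of_sum_ne_zero hb
  rw [coeff_smul, smul_eq_mul] at hbj
  exact (mo.le_degree (mem_support_iff.2 (right_ne_zero_of_mul hbj))).trans
    (hmax j (Finset.mem_filter.2 ⟨hj, left_ne_zero_of_mul hbj⟩))

variable {r N : ℕ} {σ : Type*} (v : Fin r × Fin N ≃ σ) (mo : MonomialOrder σ)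

/-- The monomial order is diagonal: the diagonal term of each maximal minor is its leading term. -/
def IsDiagonalOrder : Prop :=
  ∀ q : Fin r → Fin N, StrictMono q → ∀ π : Equiv.Perm (Fin r), π ≠ 1 →
    mo.toSyn (∑ j, Finsupp.single (v (π j, q j)) 1) < mo.toSyn (∑ j, Finsupp.single (v (j, q j)) 1)

/-- The exponent of the diagonal term of the product of minors given by a tableau. -/
def tabDegree {w : ℕ} (s : Fin r × Fin w → Fin N) : σ →₀ ℕ :=
  ∑ b, Finsupp.single (v (b.1, s b)) 1

variable {mo}

/-- In the Leibniz expansion only the identity yields the diagonal monomial, with coefficient 1, and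
every other term is smaller. -/
theorem minor_ne_zero_and_degree (hmo : IsDiagonalOrder v mo) {q : Fin r → Fin N}
    (hq : StrictMono q) :
    minor v q ≠ 0 ∧ mo.degree (minor v q) = ∑ j, Finsupp.single (v (j, q j)) 1 := by
  classical
  have hexp : minor v q = ∑ π : Equiv.Perm (Fin r), (Equiv.Perm.sign π : ℤ) •
      monomial (∑ j, Finsupp.single (v (π j, q j)) 1) (1 : ℂ) := by
    rw [minor, Matrix.det_apply]
    refine Finset.sum_congr rfl fun π _ => ?_
    rw [monomial_sum_one]
    rfl
  have hle (π : Equiv.Perm (Fin r)) : mo.toSyn (∑ j, Finsupp.single (v (π j, q j)) 1) ≤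
      mo.toSyn (∑ j, Finsupp.single (v (j, q j)) 1) := by
    by_cases h : π = 1
    · rw [h]; rfl
    · exact (hmo q hq π h).le
  have hcoeff : coeff (∑ j, Finsupp.single (v (j, q j)) 1) (minor v q) = 1 := by
    rw [hexp, coeff_sum, Finset.sum_eq_single 1]
    · simp
    · intro π _ hπ
      rw [zsmul_eq_mul, ← map_intCast (C : ℂ →+* MvPolynomial σ ℂ), coeff_C_mul, coeff_monomial,
        if_neg, mul_zero]
      intro h
      exact (hmo q hq π hπ).ne (congrArg mo.toSyn h)
    · simp
  have hne : minor v q ≠ 0 := fun h => by rw [h, coeff_zero] at hcoeff; exact zero_ne_one hcoeff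
  refine ⟨hne, mo.toSyn.injective (le_antisymm ?_ (mo.le_degree ?_))⟩
  · rw [mo.degree_le_iff]
    intro b hb
    rw [mem_support_iff, hexp, coeff_sum] at hb
    obtain ⟨π, -, hπ⟩ := Finset.exists_ne_zero_of_sum_ne_zero hb
    rw [zsmul_eq_mul, ← map_intCast (C : ℂ →+* MvPolynomial σ ℂ), coeff_C_mul, coeff_monomial]
      at hπ
    have := (ite_ne_right_iff.1 (right_ne_zero_of_mul hπ)).1
    rw [← this]
    exact hle π
  · rw [mem_support_iff, hcoeff]
    exact one_ne_zero

theorem minorProd_ne_zero_and_degree (hmo : IsDiagonalOrder v mo) {w : ℕ}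
    {s : Fin r × Fin w → Fin N} (hs : IsStandard s) :
    minorProd v s ≠ 0 ∧ mo.degree (minorProd v s) = tabDegree v s := by
  have h (c : Fin w) := minor_ne_zero_and_degree v hmo (hs.2 c)
  refine ⟨Finset.prod_ne_zero_iff.2 fun c _ => (h c).1, ?_⟩
  rw [minorProd, mo.degree_prod fun c _ => (h c).1, tabDegree, Fintype.sum_prod_type_right]
  exact Finset.sum_congr rfl fun c _ => (h c).2

theorem tabDegree_apply {w : ℕ} (s : Fin r × Fin w → Fin N) (j : Fin r) (q : Fin N) :
    tabDegree v s (v (j, q)) = (Finset.univ.filter fun c => s (j, c) = q).card := by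
  classical
  rw [tabDegree, Finsupp.finsetSum_apply, Finset.card_filter, Fintype.sum_prod_type,
    Finset.sum_eq_single j]
  · refine Finset.sum_congr rfl fun c _ => ?_
    simp [Finsupp.single_apply]
  · intro i _ hij
    refine Finset.sum_eq_zero fun c _ => ?_
    simp [hij]
  · simp

/-- A weakly increasing tuple is determined by the multiplicities of its values. -/
theorem monotone_eq_of_card_eq {w : ℕ} {α : Type*} [LinearOrder α] {f g : Fin w → α}
    (hf : Monotone f) (hg : Monotone g)
    (h : ∀ q, (Finset.univ.filter fun c => f c = q).card =
      (Finset.univ.filter fun c => g c = q).card) : f = g := by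
  have hperm : (List.ofFn f).Perm (List.ofFn g) := by
    rw [← Multiset.coe_eq_coe, ← Fin.univ_val_map, ← Fin.univ_val_map]
    ext q
    rw [Multiset.count_map, Multiset.count_map]
    have := h q
    simp only [Finset.card_def, Finset.filter_val] at this
    simpa only [eq_comm] using this
  exact List.ofFn_injective
    (hperm.eq_of_pairwise' hf.sortedLE_ofFn.pairwise hg.sortedLE_ofFn.pairwise)

/-- The exponents count how often each entry occurs in each row, and a weakly increasing row is
determined by these counts. -/
theorem tabDegree_injOn {w : ℕ} {s t : Fin r × Fin w → Fin N} (hs : IsStandard s)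
    (ht : IsStandard t) (h : tabDegree v s = tabDegree v t) : s = t := by
  ext1 ⟨j, c⟩
  refine congrFun (monotone_eq_of_card_eq (hs.1 j) (ht.1 j) fun q => ?_) c
  rw [← tabDegree_apply v, ← tabDegree_apply v, h]

/-- Standard products have distinct leading monomials, so the largest one in a combination cannot
cancel. -/
theorem exists_degree_eq_tabDegree (hmo : IsDiagonalOrder v mo) {w : ℕ} {f : MvPolynomial σ ℂ}
    (hf : f ∈ standardSpan v w) (hf0 : f ≠ 0) :
    ∃ s : Fin r × Fin w → Fin N, IsStandard s ∧ mo.degree f = tabDegree v s := by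
  classical
  have : Fintype {s : Fin r × Fin w → Fin N // IsStandard s} := Fintype.ofFinite _
  obtain ⟨a, rfl⟩ := (Submodule.mem_span_range_iff_exists_fun ℂ).1 hf
  obtain ⟨s, -, hs, -⟩ := exists_degree_sum_eq mo Finset.univ
    (fun s : {s : Fin r × Fin w → Fin N // IsStandard s} => minorProd v s.1) a
    (fun s _ => (minorProd_ne_zero_and_degree v hmo s.2).1)
    (fun s _ t _ hst => Subtype.ext (tabDegree_injOn v s.2 t.2 (by
      simpa only [(minorProd_ne_zero_and_degree v hmo s.2).2,
        (minorProd_ne_zero_and_degree v hmo t.2).2] using hst)))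
    (by
      by_contra! h
      exact hf0 (Finset.sum_eq_zero fun i hi => by rw [h i hi, zero_smul]))
  exact ⟨s.1, s.2, hs.trans (minorProd_ne_zero_and_degree v hmo s.2).2⟩

theorem fin_val_le_of_strictMono {q : Fin r → Fin N} (hq : StrictMono q) (j : Fin r) :
    (j : ℕ) ≤ q j := by
  obtain ⟨j, hj⟩ := j
  induction j with
  | zero => exact Nat.zero_le _
  | succ j ih =>
    have h1 := ih (by omega)
    have h2 : q ⟨j, by omega⟩ < q ⟨j + 1, hj⟩ := hq (by simp [Fin.lt_def])
    simp only [Fin.lt_def] at h2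
    simp only at h1 ⊢
    omega

/-- If the diagonal monomial of the first `r` columns divides the monomial of a standard tableau
`k` times, then the first `k` columns of the tableau are `(0, …, r - 1)`. -/
theorem exists_tabDegree_eq_of_add {k w : ℕ} {s : Fin r × Fin (k + w) → Fin N}
    (hs : IsStandard s) (hrN : r ≤ N) {m : σ →₀ ℕ}
    (hm : tabDegree v s = k • (∑ j, Finsupp.single (v (j, Fin.castLE hrN j)) 1) + m) :
    ∃ t : Fin r × Fin w → Fin N, IsStandard t ∧ m = tabDegree v t := by
  classical
  -- Row `j` has no entry below `j` and, by `hm`, contains `j` at least `k` times. An entry above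
  -- `j` at a place `c < k` would leave only the `c` places before it for these.
  have hfirst (j : Fin r) (c : Fin k) : s (j, Fin.castAdd w c) = Fin.castLE hrN j := by
    by_contra hne
    have hlt : Fin.castLE hrN j < s (j, Fin.castAdd w c) :=
      lt_of_le_of_ne (fin_val_le_of_strictMono (hs.2 _) j) (Ne.symm hne)
    have hk : k ≤ tabDegree v s (v (j, Fin.castLE hrN j)) := by
      rw [hm, Finsupp.add_apply, Finsupp.smul_apply, Finsupp.finsetSum_apply,
        Finset.sum_eq_single j]
      · simp
      · intro i _ hij
        simp [hij]
      · simp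
    rw [tabDegree_apply] at hk
    have hsub : (Finset.univ.filter fun d => s (j, d) = Fin.castLE hrN j) ⊆
        Finset.Iio (Fin.castAdd w c) := by
      intro d hd
      rw [Finset.mem_filter] at hd
      rw [Finset.mem_Iio]
      by_contra hcd
      exact (hlt.trans_le (hs.1 j (not_lt.1 hcd))).ne' hd.2
    have := hk.trans (Finset.card_le_card hsub)
    rw [Fin.card_Iio] at this
    exact absurd c.2 (not_lt.2 this)
  refine ⟨fun b => s (b.1, Fin.natAdd k b.2), ⟨fun j c d hcd => hs.1 j ?_,
    fun c => hs.2 (Fin.natAdd k c)⟩, ?_⟩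
  · exact Fin.le_def.2 (Nat.add_le_add_left (Fin.le_def.1 hcd) k)
  · have hsum : tabDegree v s = k • (∑ j, Finsupp.single (v (j, Fin.castLE hrN j)) 1) +
        tabDegree v fun b : Fin r × Fin w => s (b.1, Fin.natAdd k b.2) := by
      simp only [tabDegree, Fintype.sum_prod_type, Fin.sum_univ_add, hfirst,
        Finset.sum_add_distrib, Finset.smul_sum, Finset.sum_const, Finset.card_univ,
        Fintype.card_fin]
    exact add_left_cancel (hm.symm.trans hsum)

end LeadingMonomials

/-! ### Leading monomials of semi-invariants of `GL(r)` -/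

section OneSided

open MvPolynomial

theorem coeff_aeval_C_mul_X {σ : Type*} (a : ℂ) (f : MvPolynomial σ ℂ) (n : σ →₀ ℕ) :
    coeff n (aeval (fun x => C a * X x : σ → MvPolynomial σ ℂ) f) = a ^ n.degree * coeff n f := by
  classical
  induction f using MvPolynomial.induction_on' with
  | monomial m c =>
    have : aeval (fun x => C a * X x : σ → MvPolynomial σ ℂ) (monomial m c) =
        C (a ^ m.degree) * monomial m c := by
      rw [aeval_monomial, Finsupp.prod, Finset.prod_congr rfl fun x _ => mul_pow _ _ _,
        Finset.prod_mul_distrib, Finset.prod_pow_eq_pow_sum, monomial_eq, Finsupp.prod,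
        Finsupp.degree_apply, algebraMap_eq, C_pow]
      ring
    rw [this, coeff_C_mul, coeff_monomial]
    split_ifs with h
    · rw [h]
    · simp
  | add p q hp hq => rw [map_add, coeff_add, coeff_add, hp, hq, mul_add]

variable {r N : ℕ} {σ : Type*} (v : Fin r × Fin N ≃ σ)

/-- The substitution of `g * M` for the generic matrix `M`. -/
def leftMul (g : Matrix (Fin r) (Fin r) ℂ) : MvPolynomial σ ℂ →ₐ[ℂ] MvPolynomial σ ℂ :=
  aeval fun x => ∑ l, C (g (v.symm x).1 l) * X (v (l, (v.symm x).2))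

theorem eval_leftMul (g : Matrix (Fin r) (Fin r) ℂ) (p : σ → ℂ) (f : MvPolynomial σ ℂ) :
    eval p (leftMul v g f) =
      eval (fun x => ∑ l, g (v.symm x).1 l * p (v (l, (v.symm x).2))) f := by
  rw [leftMul, map_aeval]
  simp only [map_sum, map_mul, eval_C, eval_X]
  congr 1
  ext <;> simp

/-- A polynomial `f` with `f (g M) = det(g) ^ α * f M` for all invertible `g`. -/
def IsDetSemiInvariant (α : ℤ) (f : MvPolynomial σ ℂ) : Prop :=
  ∀ g : Matrix (Fin r) (Fin r) ℂ, g.det ≠ 0 → leftMul v g f = g.det ^ α • f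

variable {v}

/-- Test on the scalar matrix 2: a monomial of degree n is scaled by 2 ^ n and must be scaled by 2 ^
(r α). Hence f is homogeneous of degree r α. -/
theorem IsDetSemiInvariant.degree_eq {α : ℤ} {f : MvPolynomial σ ℂ}
    (hf : IsDetSemiInvariant v α f) {n : σ →₀ ℕ} (hn : n ∈ f.support) : (n.degree : ℤ) = r * α := by
  have hdet : (Matrix.diagonal fun _ : Fin r => (2 : ℂ)).det = 2 ^ r := by simp
  have h := hf (Matrix.diagonal fun _ => 2) (by rw [hdet]; exact pow_ne_zero _ two_ne_zero)
  have hsubst : leftMul v (Matrix.diagonal fun _ => 2) =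
      aeval (fun x => C 2 * X x : σ → MvPolynomial σ ℂ) := by
    unfold leftMul
    congr 1
    ext1 x
    rw [Finset.sum_eq_single (v.symm x).1]
    · simp
    · intro l _ hl
      rw [Matrix.diagonal_apply_ne _ hl.symm, C_0, zero_mul]
    · simp
  rw [hsubst, hdet] at h
  have hcoeff := congrArg (coeff n) h
  rw [coeff_aeval_C_mul_X, coeff_smul, smul_eq_mul] at hcoeff
  have h2 := mul_right_cancel₀ (mem_support_iff.1 hn) hcoeff
  rw [← zpow_natCast, ← zpow_natCast, ← zpow_mul] at h2
  have h3 : (2 : ℝ) ^ (n.degree : ℤ) = 2 ^ ((r : ℤ) * α) := by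
    simpa only [norm_zpow, Complex.norm_ofNat] using congrArg norm h2
  exact zpow_right_injective₀ two_pos (by norm_num) h3

/-- If there are fewer columns than rows, there are no semi-invariants of nonzero weight. -/
theorem IsDetSemiInvariant.eq_zero_of_lt {w : ℕ} {f : MvPolynomial σ ℂ}
    (hf : IsDetSemiInvariant v (w : ℤ) f) (hN : N < r) (hw : w ≠ 0) : f = 0 := by
  refine MvPolynomial.funext fun p => ?_
  rw [map_zero]
  let M : Matrix (Fin r) (Fin N) ℂ := Matrix.of fun j q => p (v (j, q))
  obtain ⟨u, hu, hu0⟩ := (Submodule.ne_bot_iff _).1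
    (LinearMap.ker_ne_bot_of_finrank_lt (f := M.vecMulLinear) (by simpa using hN))
  obtain ⟨l, hl⟩ := Function.ne_iff.1 hu0
  have huM (q : Fin N) : ∑ a, u a * p (v (a, q)) = 0 := congrFun (LinearMap.mem_ker.1 hu) q
  -- With `u` in the left kernel of `M`, this rank-one perturbation of the identity fixes `M` and
  -- has determinant 2, so f(M) = 2 ^ w f(M).
  let g : Matrix (Fin r) (Fin r) ℂ := 1 + Matrix.replicateCol Unit (Pi.single l (u l)⁻¹) *
    Matrix.replicateRow Unit u
  have hdet : g.det = 2 := by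
    rw [Matrix.det_one_add_replicateCol_mul_replicateRow, dotProduct_single,
      mul_inv_cancel₀ hl]
    norm_num
  have hg := congrArg (eval p) (hf g (by rw [hdet]; norm_num))
  have hfix : (fun x => ∑ a, g (v.symm x).1 a * p (v (a, (v.symm x).2))) = p := by
    ext1 x
    have h1 (a : Fin r) : g (v.symm x).1 a = (1 : Matrix (Fin r) (Fin r) ℂ) (v.symm x).1 a +
        (Pi.single l (u l)⁻¹ : Fin r → ℂ) (v.symm x).1 * u a := by
      simp [g, Matrix.mul_apply]
    simp_rw [h1, add_mul, Finset.sum_add_distrib, mul_assoc, ← Finset.mul_sum, huM, mul_zero,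
      add_zero, Matrix.one_apply]
    simp
  rw [eval_leftMul, hfix, hdet, smul_eval, zpow_natCast] at hg
  have h2 : (2 : ℂ) ^ w ≠ 1 := by
    have : (2 : ℕ) ^ w ≠ 1 := (Nat.one_lt_two_pow hw).ne'
    exact_mod_cast this
  have h3 : ((2 : ℂ) ^ w - 1) * eval p f = 0 := by rw [sub_mul, ← hg, one_mul, sub_self]
  exact (mul_eq_zero.1 h3).resolve_left (sub_ne_zero.2 h2)

theorem eval_minor (p : σ → ℂ) (s : Fin r → Fin N) :
    eval p (minor v s) = (Matrix.of fun a b => p (v (a, s b))).det := by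
  rw [minor, RingHom.map_det]
  congr 1
  ext a b
  simp

/-- Substituting `adj(A) * M` for `M`, where `A` consists of the first `r` columns of `M`. -/
theorem IsDetSemiInvariant.aeval_minor {w : ℕ} {f : MvPolynomial σ ℂ}
    (hf : IsDetSemiInvariant v (w : ℤ) f) (hN : r ≤ N) (h0 : minor v (Fin.castLE hN) ≠ 0) :
    aeval (fun x => minor v (Function.update (Fin.castLE hN) (v.symm x).1 (v.symm x).2)) f =
      minor v (Fin.castLE hN) ^ ((r - 1) * w) * f := by
  -- The extra factor makes the identity trivial at points where the first minor vanishes, so only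
  -- invertible `A` need be considered.
  refine mul_left_cancel₀ h0 (MvPolynomial.funext fun p => ?_)
  rw [map_mul, map_mul]
  let A : Matrix (Fin r) (Fin r) ℂ := Matrix.of fun a b => p (v (a, Fin.castLE hN b))
  have hA : eval p (minor v (Fin.castLE hN)) = A.det := eval_minor p _
  by_cases hdet : A.det = 0
  · rw [hA, hdet, zero_mul, zero_mul]
  congr 1
  have hadj : A.adjugate.det = A.det ^ (r - 1) := by
    rw [Matrix.det_adjugate, Fintype.card_fin]
  have h := congrArg (eval p) (hf A.adjugate (by rw [hadj]; exact pow_ne_zero _ hdet))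
  rw [eval_leftMul, smul_eval, zpow_natCast, hadj, ← pow_mul] at h
  rw [map_mul, map_pow, hA, ← h, map_aeval]
  -- Cramer's rule: the entries of adj(A) M are the minors of M with one of the first `r` columns
  -- replaced.
  have hpt : (fun x => eval p (minor v
      (Function.update (Fin.castLE hN) (v.symm x).1 (v.symm x).2))) =
      fun x => ∑ l, A.adjugate (v.symm x).1 l * p (v (l, (v.symm x).2)) := by
    ext1 x
    have := congrFun (Matrix.cramer_eq_adjugate_mulVec A fun l => p (v (l, (v.symm x).2)))
      (v.symm x).1
    rw [Matrix.cramer_apply] at this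
    refine (eval_minor p _).trans (Eq.trans ?_ this)
    congr 1
    ext a b
    rw [Matrix.updateCol_apply, Matrix.of_apply, Function.update_apply]
    split_ifs <;> rfl
  rw [hpt]
  congr 1
  ext <;> simp

/-- The variables of the monomial, listed with multiplicity, become the columns of the tableau. -/
theorem exists_prod_pow_eq_minorProd (u : σ → Fin r → Fin N) (n : σ →₀ ℕ) {W : ℕ}
    (hn : n.degree = W) :
    ∃ s : Fin r × Fin W → Fin N, n.prod (fun x k => minor v (u x) ^ k) = minorProd v s := by
  have hlen : n.toMultiset.toList.length = W := by
    rw [Multiset.length_toList, Finsupp.card_toMultiset, ← hn]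
    rfl
  subst hlen
  refine ⟨fun b => u (n.toMultiset.toList.get b.2) b.1, ?_⟩
  have h1 : n.prod (fun x k => minor v (u x) ^ k) =
      (n.toMultiset.toList.map fun x => minor v (u x)).prod := by
    rw [← Multiset.prod_coe, ← Multiset.map_coe, Multiset.coe_toList, Finsupp.toMultiset_map,
      Finsupp.prod_toMultiset, Finsupp.prod_mapDomain_index (by simp) (by intros; rw [pow_add])]
  rw [h1, ← Fin.prod_univ_fun_getElem]
  rfl

/-- The leading monomial of a semi-invariant for a diagonal monomial order is that of a standard
tableau. -/
theorem IsDetSemiInvariant.exists_degree_eq {mo : MonomialOrder σ} (hmo : IsDiagonalOrder v mo)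
    (hr : 0 < r) {α : ℤ} {f : MvPolynomial σ ℂ} (hf : IsDetSemiInvariant v α f) (hf0 : f ≠ 0) :
    ∃ w : ℕ, (w : ℤ) = α ∧ ∃ t : Fin r × Fin w → Fin N, IsStandard t ∧
      mo.degree f = tabDegree v t := by
  have hdeg := hf.degree_eq (mo.degree_mem_support hf0)
  obtain ⟨w, rfl⟩ : ∃ w : ℕ, (w : ℤ) = α := by
    refine ⟨α.toNat, Int.toNat_of_nonneg ?_⟩
    by_contra hneg
    have : (r : ℤ) * α < 0 := mul_neg_of_pos_of_neg (by exact_mod_cast hr) (not_le.1 hneg)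
    omega
  refine ⟨w, rfl, ?_⟩
  -- Without maximal minors only weight 0 is possible; then f is constant and the empty tableau
  -- serves.
  rcases lt_or_ge N r with hN | hN
  · obtain rfl : w = 0 := by
      by_contra hw
      exact hf0 (hf.eq_zero_of_lt hN hw)
    have h0 : mo.degree f = 0 := (Finsupp.degree_eq_zero_iff _).1 (by simpa using hdeg)
    exact ⟨fun b => b.2.elim0, ⟨fun _ c => c.elim0, fun c => c.elim0⟩, by simp [h0, tabDegree]⟩
  have hfirst := minor_ne_zero_and_degree v hmo (Fin.strictMono_castLE hN)
  have hadj := hf.aeval_minor hN hfirst.1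
  -- After the adjugate substitution every variable is a minor, so a monomial of degree `r * w`
  -- becomes a product of `r * w` minors. The diagonal monomial of the power is afterwards removed
  -- from the leading monomial.
  have hmem : minor v (Fin.castLE hN) ^ ((r - 1) * w) * f ∈ standardSpan v ((r - 1) * w + w) := by
    rw [← hadj, f.as_sum, map_sum]
    refine Submodule.sum_mem _ fun n hn => ?_
    have hnW : n.degree = (r - 1) * w + w := by
      have h1 := hf.degree_eq hn
      rw [← Nat.succ_mul, Nat.succ_eq_add_one, Nat.sub_add_cancel hr]
      exact_mod_cast h1
    obtain ⟨s, hs⟩ := exists_prod_pow_eq_minorProd (v := v)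
      (fun x => Function.update (Fin.castLE hN) (v.symm x).1 (v.symm x).2) n hnW
    rw [aeval_monomial, hs, ← Algebra.smul_def]
    exact Submodule.smul_mem _ _ (minorProd_mem_standardSpan v s)
  obtain ⟨s, hs, hsdeg⟩ := exists_degree_eq_tabDegree v hmo hmem
    (mul_ne_zero (pow_ne_zero _ hfirst.1) hf0)
  rw [mo.degree_mul (pow_ne_zero _ hfirst.1) hf0, mo.degree_pow, hfirst.2] at hsdeg
  exact exists_tabDegree_eq_of_add v hs hN hsdeg.symm

end OneSided

/-! ### Relabellings of the edges of a linked pair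

The boxes of a linked pair are the edges of a bipartite graph whose vertices are the columns of the
two tableaux. Column permutations relabel the edges. -/

section Relabelling

open Classical in
/-- A counting argument for a cut in a bipartite graph. -/
theorem forall_not_of_cut {E : Type*} {NL NT Z : Finset E} (hZ : Disjoint NL Z)
    (p q : E → Prop)
    (hp : (NL.filter p).card = (NT.filter p).card) (hq : (NL.filter q).card = (NT.filter q).card)
    (h1 : ∀ e ∈ NL ∪ Z, e ∉ NT → p e → q e) (h2 : ∀ e ∈ NT, q e → p e) (h3 : ∀ e ∈ Z, ¬ q e) :
    ∀ e ∈ Z, ¬ p e := by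
  -- Compare the numbers of `p`- and `q`-edges in `NL ∪ Z`: the edges of the former kind not of the
  -- latter all lie in `NT`, where they are exactly made up for by the two equal counts, leaving no
  -- room for `p`-edges in `Z`.
  have hS1 : ((NL ∪ Z).filter p).card = (NT.filter p).card + (Z.filter p).card := by
    rw [Finset.filter_union, Finset.card_union_of_disjoint
      (Finset.disjoint_filter_filter hZ), hp]
  have hS2 : ((NL ∪ Z).filter q).card = (NT.filter q).card := by
    rw [Finset.filter_union, Finset.filter_false_of_mem h3, Finset.union_empty, hq]
  have hS3 : ((NL ∪ Z).filter p).card ≤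
      ((NL ∪ Z).filter q).card + (NT.filter fun e => p e ∧ ¬ q e).card := by
    refine (Finset.card_le_card fun e he => ?_).trans (Finset.card_union_le _ _)
    rw [Finset.mem_filter] at he
    by_cases hqe : q e
    · exact Finset.mem_union_left _ (Finset.mem_filter.2 ⟨he.1, hqe⟩)
    · exact Finset.mem_union_right _ (Finset.mem_filter.2
        ⟨by_contra fun hNT => hqe (h1 e he.1 hNT he.2), he.2, hqe⟩)
  have hS4 : (NT.filter q).card + (NT.filter fun e => p e ∧ ¬ q e).card ≤
      (NT.filter p).card := by
    rw [← Finset.card_union_of_disjoint]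
    · refine Finset.card_le_card (Finset.union_subset (fun e he => ?_) fun e he => ?_)
      · rw [Finset.mem_filter] at he ⊢
        exact ⟨he.1, h2 e he.1 he.2⟩
      · rw [Finset.mem_filter] at he ⊢
        exact ⟨he.1, he.2.1⟩
    · exact Finset.disjoint_filter.2 fun e _ hqe h => h.2 hqe
  have : (Z.filter p).card = 0 := by omega
  intro e he hpe
  rw [Finset.card_eq_zero] at this
  exact Finset.notMem_empty e (this ▸ Finset.mem_filter.2 ⟨he, hpe⟩)

variable {K r₀ r₁ : ℕ} {E C D : Type*}

/-- The edges `E` of a bipartite graph, with end points `c e` and `d e`, carry two labellings `T`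
and `L` by variables `(i, j, k)` with the same colours `i`. At a vertex of the first kind, the
indices `j` are distinct, and so are the indices `k` at a vertex of the second kind. The labelling
`T` is strictly increasing at each vertex. -/
structure IsRelabelling (c : E → C) (d : E → D) (T L : E → Fin K × Fin r₁ × Fin r₀) : Prop where
  color : ∀ e, (L e).1 = (T e).1
  inj_left : ∀ e e', c e = c e' → (L e).2.1 = (L e').2.1 → e = e'
  inj_right : ∀ e e', d e = d e' → (L e).2.2 = (L e').2.2 → e = e'
  inj_left' : ∀ e e', c e = c e' → (T e).2.1 = (T e').2.1 → e = e'
  inj_right' : ∀ e e', d e = d e' → (T e).2.2 = (T e').2.2 → e = e'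
  exists_left : ∀ e, ∃ e', c e' = c e ∧ (T e').2.1 = (L e).2.1
  exists_right : ∀ e, ∃ e', d e' = d e ∧ (T e').2.2 = (L e).2.2
  color_left : ∀ e e', c e = c e' → (T e).2.1 < (T e').2.1 → (T e).1 ≤ (T e').1
  color_right : ∀ e e', d e = d e' → (T e).2.2 < (T e').2.2 → (T e).1 ≤ (T e').1
  strict_left : ∀ e e', c e = c e' → (T e).1 = (T e').1 → (T e).2.1 ≤ (T e').2.1 →
    ((T e).2.2 : ℕ) + (T e').2.1 ≤ (T e').2.2 + (T e).2.1
  strict_right : ∀ e e', d e = d e' → (T e).1 = (T e').1 → (T e).2.2 ≤ (T e').2.2 →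
    ((T e).2.1 : ℕ) + (T e').2.2 ≤ (T e').2.1 + (T e).2.2

/-- The edges with label `x` have the same end points in both labellings. -/
def AgreeAt (c : E → C) (d : E → D) (T L : E → Fin K × Fin r₁ × Fin r₀)
    (x : Fin K × Fin r₁ × Fin r₀) : Prop :=
  (∀ b, (∃ e, L e = x ∧ c e = b) ↔ ∃ e, T e = x ∧ c e = b) ∧
    ∀ b, (∃ e, L e = x ∧ d e = b) ↔ ∃ e, T e = x ∧ d e = b

open Classical in
/-- If two labellings agree on the labels satisfying `P`, then the numbers of edges with these
labels at a set of vertices are equal. -/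
theorem card_filter_eq_of_agree {V : Type*} [Fintype E] (c : E → C) (T L : E → V)
    (P : V → Prop) [DecidablePred P] (p : E → Prop)
    (hp : ∀ e e', c e = c e' → p e → p e')
    (hL : ∀ e e', L e = L e' → c e = c e' → e = e') (hT : ∀ e e', T e = T e' → c e = c e' → e = e')
    (h : ∀ x, P x → ∀ b, (∃ e, L e = x ∧ c e = b) ↔ ∃ e, T e = x ∧ c e = b) :
    ((Finset.univ.filter fun e => P (L e)).filter p).card =
      ((Finset.univ.filter fun e => P (T e)).filter p).card := by
  rw [← Finset.card_image_of_injective _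
      (fun e e' hee => hL e e' (congrArg Prod.fst hee) (congrArg Prod.snd hee) :
        Function.Injective fun e => (L e, c e)),
    ← Finset.card_image_of_injective _
      (fun e e' hee => hT e e' (congrArg Prod.fst hee) (congrArg Prod.snd hee) :
        Function.Injective fun e => (T e, c e))]
  congr 1
  ext ⟨x, b⟩
  simp only [Finset.mem_image, Finset.mem_filter, Finset.mem_univ, true_and, Prod.mk.injEq]
  constructor
  · rintro ⟨e, ⟨hx, hpe⟩, rfl, rfl⟩
    obtain ⟨e', he', hc⟩ := (h _ hx _).1 ⟨e, rfl, rfl⟩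
    exact ⟨e', ⟨he' ▸ hx, hp _ _ hc.symm hpe⟩, he', hc⟩
  · rintro ⟨e, ⟨hx, hpe⟩, rfl, rfl⟩
    obtain ⟨e', he', hc⟩ := (h _ hx _).2 ⟨e, rfl, rfl⟩
    exact ⟨e', ⟨he' ▸ hx, hp _ _ hc.symm hpe⟩, he', hc⟩

namespace IsRelabelling

variable {c : E → C} {d : E → D} {T L : E → Fin K × Fin r₁ × Fin r₀}

/-- If the labellings agree below `x`, then the edges with label `x` in `L` end in vertices of the
first kind in which edges with label `x` in `T` end, and likewise for those of the second kind. -/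
theorem exists_of_agree_lt [Fintype E] (h : IsRelabelling c d T L)
    {x : Fin K × Fin r₁ × Fin r₀}
    (hx : ∀ y, lexVar K r₀ r₁ y < lexVar K r₀ r₁ x → AgreeAt c d T L y) {e : E} (he : L e = x) :
    (∃ e', T e' = x ∧ c e' = c e) ∧ ∃ e', T e' = x ∧ d e' = d e := by
  classical
  obtain ⟨i, j, k⟩ := x
  have hlt (y) : lexVar K r₀ r₁ y < lexVar K r₀ r₁ (i, j, k) ↔
      y.1 < i ∨ y.1 = i ∧ (y.2.1 < j ∨ y.2.1 = j ∧ y.2.2 < k) := lexVar_lt_iff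
  -- Only labels of colour `i` below `x` enter the count, since relabelling keeps colours.
  let P : Fin K × Fin r₁ × Fin r₀ → Prop := fun y =>
    y.1 = i ∧ (y.2.1 < j ∨ y.2.1 = j ∧ y.2.2 < k)
  have hP {y} (hy : P y) : lexVar K r₀ r₁ y < lexVar K r₀ r₁ (i, j, k) := (hlt y).2 (Or.inr hy)
  let NL : Finset E := Finset.univ.filter fun e => P (L e)
  let NT : Finset E := Finset.univ.filter fun e => P (T e)
  let Z : Finset E := Finset.univ.filter fun e => L e = (i, j, k)
  have hZ : Disjoint NL Z := Finset.disjoint_filter.2 fun e _ hPe hLe => by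
    rw [hLe] at hPe
    simp [P] at hPe
  have hcard_left (p : E → Prop) (hp : ∀ e e', c e = c e' → p e → p e') :
      (NL.filter p).card = (NT.filter p).card :=
    card_filter_eq_of_agree c T L P p hp
      (fun e e' he hc => h.inj_left e e' hc (by rw [he]))
      (fun e e' he hc => h.inj_left' e e' hc (by rw [he])) fun y hy => (hx y (hP hy)).1
  have hcard_right (p : E → Prop) (hp : ∀ e e', d e = d e' → p e → p e') :
      (NL.filter p).card = (NT.filter p).card :=
    card_filter_eq_of_agree d T L P p hp
      (fun e e' he hd => h.inj_right e e' hd (by rw [he]))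
      (fun e e' he hd => h.inj_right' e e' hd (by rw [he])) fun y hy => (hx y (hP hy)).2
  have hS {e : E} (he : e ∈ NL ∪ Z) (hNT : e ∉ NT) :
      (T e).1 = i ∧ (j < (T e).2.1 ∨ j = (T e).2.1 ∧ k ≤ (T e).2.2) := by
    have hi : (T e).1 = i := by
      rw [← h.color]
      rcases Finset.mem_union.1 he with he | he
      · exact (Finset.mem_filter.1 he).2.1
      · rw [(Finset.mem_filter.1 he).2]
    refine ⟨hi, ?_⟩
    by_contra hcon
    refine hNT (Finset.mem_filter.2 ⟨Finset.mem_univ _, hi, ?_⟩)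
    simp only [Fin.lt_def, Fin.le_def, Fin.ext_iff] at hcon ⊢
    omega
  -- If `e'` had a `T`-label below `x`, agreement would give an `L`-edge with that label at `c e`;
  -- it shares the index `j` with `e`, hence equals `e`, whose label is `x`.
  have hZ_left {e e' : E} (he : L e = (i, j, k)) (hc : c e' = c e) (hj : (T e').2.1 = j) :
      i < (T e').1 ∨ i = (T e').1 ∧ k ≤ (T e').2.2 := by
    by_contra hcon
    have hlt' : lexVar K r₀ r₁ (T e') < lexVar K r₀ r₁ (i, j, k) := by
      rw [hlt]
      simp only [Fin.lt_def, Fin.le_def, Fin.ext_iff] at hcon hj ⊢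
      omega
    obtain ⟨e'', he'', hc''⟩ := ((hx _ hlt').1 (c e)).2 ⟨e', rfl, hc⟩
    obtain rfl := h.inj_left e'' e hc'' (by rw [he'', he, hj])
    rw [← he'', he] at hlt'
    exact lt_irrefl _ hlt'
  have hZ_right {e e' : E} (he : L e = (i, j, k)) (hd : d e' = d e) (hk : (T e').2.2 = k) :
      i < (T e').1 ∨ i = (T e').1 ∧ j ≤ (T e').2.1 := by
    by_contra hcon
    have hlt' : lexVar K r₀ r₁ (T e') < lexVar K r₀ r₁ (i, j, k) := by
      rw [hlt]
      simp only [Fin.lt_def, Fin.le_def, Fin.ext_iff] at hcon hk ⊢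
      omega
    obtain ⟨e'', he'', hd''⟩ := ((hx _ hlt').2 (d e)).2 ⟨e', rfl, hd⟩
    obtain rfl := h.inj_right e'' e hd'' (by rw [he'', he, hk])
    rw [← he'', he] at hlt'
    exact lt_irrefl _ hlt'
  constructor
  · obtain ⟨e₁, hc₁, hj₁⟩ := h.exists_left e
    rw [he] at hj₁
    -- The cut separates vertices by the diagonal offset k' − j' against k − j, written additively
    -- in ℕ. Within a colour, strictness makes this offset weakly increasing in j' at a vertex of
    -- the first kind and weakly decreasing in k' at one of the second. If the claim failed, `e₁`
    -- would put `e` on the forbidden side.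
    have hcut := forall_not_of_cut hZ
      (fun e => ∃ e', c e' = c e ∧
        ((T e').2.1 = j ∧ (i < (T e').1 ∨ i = (T e').1 ∧ k < (T e').2.2) ∨
        (T e').1 = i ∧ (T e').2.1 ≤ j ∧ (k : ℕ) + (T e').2.1 < (T e').2.2 + j))
      (fun e => ∃ e', d e' = d e ∧
        (T e').1 = i ∧ j ≤ (T e').2.1 ∧ (k : ℕ) + (T e').2.1 < (T e').2.2 + j)
      (hcard_left _ fun a b hab ⟨e', hc, h'⟩ => ⟨e', hc.trans hab, h'⟩)
      (hcard_right _ fun a b hab ⟨e', hd, h'⟩ => ⟨e', hd.trans hab, h'⟩) ?_ ?_ ?_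
    · by_contra hcon
      refine hcut e (Finset.mem_filter.2 ⟨Finset.mem_univ _, he⟩) ⟨e₁, hc₁, Or.inl ⟨hj₁, ?_⟩⟩
      rcases hZ_left he hc₁ hj₁ with hi | ⟨hi, hk⟩
      · exact Or.inl hi
      · refine Or.inr ⟨hi, hk.lt_of_ne fun hk => hcon ⟨e₁, ?_, hc₁⟩⟩
        exact Prod.ext hi.symm (Prod.ext hj₁ hk.symm)
    · rintro a ha haNT ⟨b, hb, hcase⟩
      have ha' := hS ha haNT
      refine ⟨a, rfl, ha'.1, ?_⟩
      have h1 := h.color_left b a hb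
      have h2 := h.strict_left b a hb
      have h3 := h.inj_left' b a hb
      rcases hcase with ⟨hbj, hcase⟩ | hcase
      · rcases hcase with hi | ⟨hi, hk⟩
        · exfalso
          rcases ha'.2 with hj | ⟨hj, -⟩
          · exact absurd (h1 (hbj ▸ hj)) (not_le.2 (ha'.1 ▸ hi))
          · rw [h3 (hbj.trans hj), ha'.1] at hi
            exact lt_irrefl _ hi
        · have h4 := h2 (by rw [← hi, ha'.1])
          simp only [Fin.lt_def, Fin.le_def, Fin.ext_iff] at *
          omega
      · have h4 := h2 (by rw [hcase.1, ha'.1])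
        simp only [Fin.lt_def, Fin.le_def, Fin.ext_iff] at *
        omega
    · rintro a ha ⟨b, hb, hbi, hbj, hbk⟩
      obtain ⟨-, hai, haj⟩ := Finset.mem_filter.1 ha
      refine ⟨a, rfl, Or.inr ⟨hai, ?_⟩⟩
      have h1 := h.strict_right a b hb.symm (by rw [hai, hbi])
      have h2 := h.strict_right b a hb (by rw [hai, hbi])
      simp only [Fin.lt_def, Fin.le_def, Fin.ext_iff] at *
      omega
    · rintro a ha ⟨b, hb, hbi, hbj, hbk⟩
      have ha' := (Finset.mem_filter.1 ha).2
      obtain ⟨a', ha'd, ha'k⟩ := h.exists_right a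
      rw [ha'] at ha'k
      have h1 := hZ_right ha' ha'd ha'k
      have h2 := h.color_right a' b (ha'd.trans hb.symm)
      have h3 := h.strict_right a' b (ha'd.trans hb.symm)
      simp only [Fin.lt_def, Fin.le_def, Fin.ext_iff] at *
      omega
  · obtain ⟨e₁, hd₁, hk₁⟩ := h.exists_right e
    rw [he] at hk₁
    -- The mirror image, with the two kinds of vertices exchanged and the inequality between the
    -- offsets reversed.
    have hcut := forall_not_of_cut hZ
      (fun e => ∃ e', d e' = d e ∧ ((T e').2.2 = k ∧ i < (T e').1 ∨
        (T e').1 = i ∧ (T e').2.2 ≤ k ∧ (T e').2.2 + (j : ℕ) < k + (T e').2.1))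
      (fun e => ∃ e', c e' = c e ∧
        (T e').1 = i ∧ j ≤ (T e').2.1 ∧ (T e').2.2 + (j : ℕ) < k + (T e').2.1)
      (hcard_right _ fun a b hab ⟨e', hd, h'⟩ => ⟨e', hd.trans hab, h'⟩)
      (hcard_left _ fun a b hab ⟨e', hc, h'⟩ => ⟨e', hc.trans hab, h'⟩) ?_ ?_ ?_
    · have hcut' : ¬ ((T e₁).2.2 = k ∧ i < (T e₁).1 ∨
          (T e₁).1 = i ∧ (T e₁).2.2 ≤ k ∧ (T e₁).2.2 + (j : ℕ) < k + (T e₁).2.1) :=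
        fun h' => hcut e (Finset.mem_filter.2 ⟨Finset.mem_univ _, he⟩) ⟨e₁, hd₁, h'⟩
      refine ⟨e₁, ?_, hd₁⟩
      have h1 := hZ_right he hd₁ hk₁
      simp only [Fin.lt_def, Fin.le_def, Fin.ext_iff, Prod.ext_iff] at *
      omega
    · rintro a ha haNT ⟨b, hb, hcase⟩
      have ha' := hS ha haNT
      refine ⟨a, rfl, ha'.1, ?_⟩
      have h1 := h.color_right b a hb
      have h2 := h.strict_right b a hb
      have h3 := h.inj_right' b a hb
      rcases hcase with ⟨hbk, hi⟩ | hcase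
      · have h4 : (T b).2.2 ≠ (T a).2.2 := fun hk => by
          rw [h3 hk, ha'.1] at hi
          exact lt_irrefl _ hi
        simp only [Fin.lt_def, Fin.le_def, Fin.ext_iff, ne_eq] at *
        omega
      · have h4 := h2 (by rw [hcase.1, ha'.1])
        simp only [Fin.lt_def, Fin.le_def, Fin.ext_iff] at *
        omega
    · rintro a ha ⟨b, hb, hbi, hbj, hbk⟩
      obtain ⟨-, hai, haj⟩ := Finset.mem_filter.1 ha
      refine ⟨a, rfl, Or.inr ⟨hai, ?_⟩⟩
      have h1 := h.strict_left a b hb.symm (by rw [hai, hbi])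
      simp only [Fin.lt_def, Fin.le_def, Fin.ext_iff] at *
      omega
    · rintro a ha ⟨b, hb, hbi, hbj, hbk⟩
      have ha' := (Finset.mem_filter.1 ha).2
      obtain ⟨a', ha'c, ha'j⟩ := h.exists_left a
      rw [ha'] at ha'j
      have h1 := hZ_left ha' ha'c ha'j
      have h2 := h.color_left a' b (ha'c.trans hb.symm)
      have h3 := h.strict_left a' b (ha'c.trans hb.symm)
      have h4 := h.inj_left' a' b (ha'c.trans hb.symm)
      have h5 : (T a').2.1 = (T b).2.1 → (T a').1 = (T b).1 := fun hj => by rw [h4 hj]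
      simp only [Fin.lt_def, Fin.le_def, Fin.ext_iff] at *
      omega

end IsRelabelling

end Relabelling

/-! ### Maximality of the increasing labelling and its equality case -/

section Relabelling

variable {K r₀ r₁ : ℕ} {E C D : Type*} [Fintype E]

/-- The exponent of the monomial given by a labelling of edges by variables. -/
def labelDegree {V : Type*} (T : E → V) : V →₀ ℕ := ∑ e, Finsupp.single (T e) 1

theorem labelDegree_apply {V : Type*} [DecidableEq V] (T : E → V) (x : V) :
    labelDegree T x = (Finset.univ.filter fun e => T e = x).card := by
  rw [labelDegree, Finsupp.finsetSum_apply, Finset.card_filter]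
  exact Finset.sum_congr rfl fun e _ => Finsupp.single_apply

namespace IsRelabelling

variable {c : E → C} {d : E → D} {T L : E → Fin K × Fin r₁ × Fin r₀}

/-- Edges with a common label have distinct end points of either kind, so the inclusion of end point
sets from `exists_of_agree_lt` bounds their number; equal numbers turn the inclusion into equality.
-/
theorem labelDegree_le_of_agree_lt (h : IsRelabelling c d T L) {x : Fin K × Fin r₁ × Fin r₀}
    (hx : ∀ y, lexVar K r₀ r₁ y < lexVar K r₀ r₁ x → AgreeAt c d T L y) :
    labelDegree L x ≤ labelDegree T x ∧
      (labelDegree L x = labelDegree T x → AgreeAt c d T L x) := by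
  classical
  let ZL : Finset E := Finset.univ.filter fun e => L e = x
  let ZT : Finset E := Finset.univ.filter fun e => T e = x
  have mem_ZL {e : E} : e ∈ ZL ↔ L e = x := by simp [ZL]
  have mem_ZT {e : E} : e ∈ ZT ↔ T e = x := by simp [ZT]
  have hcL : (ZL.image c).card = ZL.card := Finset.card_image_of_injOn fun e he e' he' hee =>
    h.inj_left e e' hee (by rw [mem_ZL.1 he, mem_ZL.1 he'])
  have hcT : (ZT.image c).card = ZT.card := Finset.card_image_of_injOn fun e he e' he' hee =>
    h.inj_left' e e' hee (by rw [mem_ZT.1 he, mem_ZT.1 he'])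
  have hdL : (ZL.image d).card = ZL.card := Finset.card_image_of_injOn fun e he e' he' hee =>
    h.inj_right e e' hee (by rw [mem_ZL.1 he, mem_ZL.1 he'])
  have hdT : (ZT.image d).card = ZT.card := Finset.card_image_of_injOn fun e he e' he' hee =>
    h.inj_right' e e' hee (by rw [mem_ZT.1 he, mem_ZT.1 he'])
  have hsubc : ZL.image c ⊆ ZT.image c := Finset.image_subset_iff.2 fun e he => by
    obtain ⟨e', he', hc⟩ := (h.exists_of_agree_lt hx (mem_ZL.1 he)).1
    exact Finset.mem_image.2 ⟨e', mem_ZT.2 he', hc⟩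
  have hsubd : ZL.image d ⊆ ZT.image d := Finset.image_subset_iff.2 fun e he => by
    obtain ⟨e', he', hd⟩ := (h.exists_of_agree_lt hx (mem_ZL.1 he)).2
    exact Finset.mem_image.2 ⟨e', mem_ZT.2 he', hd⟩
  rw [labelDegree_apply, labelDegree_apply]
  change ZL.card ≤ ZT.card ∧ (ZL.card = ZT.card → _)
  refine ⟨by rw [← hcL, ← hcT]; exact Finset.card_le_card hsubc,
    fun heq => ⟨fun b => ?_, fun b => ?_⟩⟩
  · have := Finset.eq_of_subset_of_card_le hsubc (by rw [hcL, hcT, heq])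
    simpa [mem_ZL, mem_ZT] using Finset.ext_iff.1 this b
  · have := Finset.eq_of_subset_of_card_le hsubd (by rw [hdL, hdT, heq])
    simpa [mem_ZL, mem_ZT] using Finset.ext_iff.1 this b

theorem agreeAt_of_labelDegree_eq (h : IsRelabelling c d T L) (x : Fin K × Fin r₁ × Fin r₀)
    (heq : ∀ y, lexVar K r₀ r₁ y ≤ lexVar K r₀ r₁ x → labelDegree L y = labelDegree T y) :
    AgreeAt c d T L x := by
  induction hy : lexVar K r₀ r₁ x using WellFoundedLT.induction generalizing x with
  | _ y ih =>
    subst hy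
    exact (h.labelDegree_le_of_agree_lt fun z hz =>
      ih _ hz z (fun z' hz' => heq z' (hz'.trans hz.le)) rfl).2 (heq x le_rfl)

/-- Among all relabellings, the strictly increasing labelling has the largest monomial. -/
theorem labelDegree_le (h : IsRelabelling c d T L) :
    (lexMonomialOrder K r₀ r₁).toSyn (labelDegree L) ≤
      (lexMonomialOrder K r₀ r₁).toSyn (labelDegree T) := by
  by_contra hlt
  obtain ⟨x, hx, hxlt⟩ := lexMonomialOrder_lt_iff.1 (not_le.1 hlt)
  exact hxlt.not_ge (h.labelDegree_le_of_agree_lt fun y hy =>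
    h.agreeAt_of_labelDegree_eq y fun z hz => (hx z (hz.trans_lt hy)).symm).1

end IsRelabelling

/-- An increasing permutation of a finite linear order is trivial. -/
theorem perm_eq_one_of_lt {α : Type*} [LinearOrder α] (f : E → α) (hf : Function.Injective f)
    (ρ : Equiv.Perm E) (h : ∀ e e', f e < f e' → f (ρ e) < f (ρ e')) : ρ = 1 := by
  let _ : LinearOrder E := LinearOrder.lift' f hf
  have hρ : StrictMono ρ := fun e e' => h e e'
  have := Subsingleton.elim (StrictMono.orderIsoOfSurjective ρ hρ ρ.surjective) (OrderIso.refl E)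
  ext1 e
  exact DFunLike.congr_fun this e

/-- A permutation that preserves the classes of a partition is trivial if it does not change the sum
of products of two functions that increase together on each class. -/
theorem perm_eq_one_of_sum_mul_eq (c d t : E → ℕ) (ρ : Equiv.Perm E) (ht : ∀ e, t (ρ e) = t e)
    (hinj : ∀ e e', t e = t e' → c e = c e' → e = e')
    (hcd : ∀ e e', t e = t e' → c e < c e' → d e < d e')
    (hsum : ∑ e, c e * d (ρ e) = ∑ e, c e * d e) : ρ = 1 := by
  -- `B` exceeds all values of `c` and `d`, so adding `B * t` orders first by class and merges the
  -- classes into one order on which both functions increase together.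
  let B : ℕ := 1 + ∑ e, (c e + d e)
  have hB (e : E) : c e < B ∧ d e < B := by
    have := Finset.single_le_sum (f := fun e => c e + d e) (fun _ _ => Nat.zero_le _)
      (Finset.mem_univ e)
    simp only [B]
    constructor <;> omega
  let f : E → ℕ := fun e => c e + B * t e
  let g : E → ℕ := fun e => d e + B * t e
  have hblock {e e' : E} (h : t e < t e') : B * t e + B ≤ B * t e' := by
    rw [← Nat.mul_succ]
    exact Nat.mul_le_mul_left _ h
  have hf (e e' : E) : f e < f e' ↔ t e < t e' ∨ t e = t e' ∧ c e < c e' := by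
    have h1 := hB e
    have h2 := hB e'
    rcases lt_trichotomy (t e) (t e') with h | h | h
    · have := hblock h
      simp only [f, h, true_or, iff_true]
      omega
    · simp [f, h]
    · have := hblock h
      have h3 : ¬ t e < t e' := h.not_gt
      simp only [f, h3, h.ne', false_and, or_false, iff_false]
      omega
  have hfg {e e' : E} (h : f e < f e') : g e < g e' := by
    have h1 := hB e
    rcases (hf e e').1 h with h | ⟨h, hc⟩
    · have := hblock h
      simp only [g]
      omega
    · have := hcd e e' h hc
      simp only [g, h]
      omega
  have hfinj : Function.Injective f := fun e e' h => by
    rcases lt_trichotomy (t e) (t e') with ht | ht | ht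
    · exact absurd h ((hf _ _).2 (Or.inl ht)).ne
    · exact hinj e e' ht (by simpa [f, ht] using h)
    · exact absurd h ((hf _ _).2 (Or.inl ht)).ne'
  have hmono : Monovary f g := fun e e' h => by
    by_contra hlt
    exact h.not_gt (hfg (not_le.1 hlt))
  -- Equality case of the rearrangement inequality.
  have hmono' : Monovary f (g ∘ ρ) := by
    rw [← hmono.sum_mul_comp_perm_eq_sum_mul_iff]
    have h1 : ∑ e, t e * d (ρ e) = ∑ e, t e * d e := by
      rw [← Equiv.sum_comp ρ fun e => t e * d e]
      exact Finset.sum_congr rfl fun e _ => by rw [ht]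
    have h2 (e : E) : f e * g (ρ e) = c e * d (ρ e) + B * (t e * d (ρ e)) + f e * (B * t e) := by
      simp only [f, g, ht]; ring
    have h3 (e : E) : f e * g e = c e * d e + B * (t e * d e) + f e * (B * t e) := by
      simp only [f, g]; ring
    simp_rw [h2, h3, Finset.sum_add_distrib, ← Finset.mul_sum, hsum, h1]
  refine perm_eq_one_of_lt f hfinj ρ fun e e' h => ?_
  have hle : f (ρ e) ≤ f (ρ e') := by
    by_contra hlt
    exact h.not_ge (hmono' (hfg (not_le.1 hlt)))
  exact lt_of_le_of_ne hle fun heq => h.ne (congrArg f (ρ.injective (hfinj heq)))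

/-- If a relabelling has the same monomial as a strictly increasing labelling whose edges with a
given label do not cross, then the permutations that move the labels at the vertices of the two
kinds coincide. -/
theorem IsRelabelling.perm_eq_of_labelDegree_eq {m n : ℕ} {c : E → Fin m} {d : E → Fin n}
    {T L : E → Fin K × Fin r₁ × Fin r₀} (h : IsRelabelling c d T L)
    (hcross : ∀ e e', T e = T e' → c e < c e' → d e < d e')
    (heq : labelDegree L = labelDegree T) (π ρ : Equiv.Perm E)
    (hπ : ∀ e, c (π e) = c e ∧ (T (π e)).2.1 = (L e).2.1)
    (hρ : ∀ e, d (ρ e) = d e ∧ (T (ρ e)).2.2 = (L e).2.2) : π = ρ := by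
  have hagree (x) := h.agreeAt_of_labelDegree_eq x fun y _ => by rw [heq]
  have hπT (e : E) : T (π e) = L e := by
    obtain ⟨e', he', hc⟩ := ((hagree (L e)).1 (c e)).1 ⟨e, rfl, rfl⟩
    rw [← h.inj_left' e' (π e) (hc.trans (hπ e).1.symm) (by rw [he', (hπ e).2]), he']
  have hρT (e : E) : T (ρ e) = L e := by
    obtain ⟨e', he', hd⟩ := ((hagree (L e)).2 (d e)).1 ⟨e, rfl, rfl⟩
    rw [← h.inj_right' e' (ρ e) (hd.trans (hρ e).1.symm) (by rw [he', (hρ e).2]), he']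
  let t : E → ℕ := fun e => Fintype.equivFin _ (T e)
  have ht {e e' : E} : t e = t e' ↔ T e = T e' := by simp [t, Fin.val_inj]
  -- Since `T ∘ π = L = T ∘ ρ`, this permutation preserves labels. As `π` keeps `c` and `ρ` keeps
  -- `d`, reindexing by `π` shows that the sum of products is unchanged.
  have hone : ρ * π⁻¹ = 1 := by
    refine perm_eq_one_of_sum_mul_eq (fun e => c e) (fun e => d e) t _ (fun e => ?_)
      (fun e e' hee hc => ?_) (fun e e' hee hc => hcross e e' (ht.1 hee) hc) ?_
    · rw [ht, Equiv.Perm.mul_apply, hρT, ← hπT]; exact congrArg T (π.apply_symm_apply e)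
    · exact h.inj_left' e e' (Fin.ext hc) (by rw [ht.1 hee])
    · rw [← Equiv.sum_comp π]
      exact Finset.sum_congr rfl fun e _ => by
        rw [Equiv.Perm.mul_apply, show π⁻¹ (π e) = e from π.symm_apply_apply e, (hπ e).1,
          (hρ e).1]
  exact (mul_inv_eq_one.1 hone).symm

end Relabelling

/-! ### Rows and columns of the two generic matrices -/

section Coordinates

open MvPolynomial

/-- A variable (i, p) gained by a non-diagonal term has p = q (π⁻¹ i) with π⁻¹ i ≠ i. It is preceded
by a lost diagonal variable: the one of row π⁻¹ i in the same column if π⁻¹ i < i, and the one of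
row i otherwise. -/
theorem isDiagonalOrder_lexMonomialOrder {K r₀ r₁ r N : ℕ}
    (v : Fin r × Fin N ≃ Fin K × Fin r₁ × Fin r₀)
    (hrow : ∀ i j q, i < j → lexVar K r₀ r₁ (v (i, q)) < lexVar K r₀ r₁ (v (j, q)))
    (hcol : ∀ j p q, p < q → lexVar K r₀ r₁ (v (j, p)) < lexVar K r₀ r₁ (v (j, q))) :
    IsDiagonalOrder v (lexMonomialOrder K r₀ r₁) := by
  intro q hq π hπ
  have happly (π : Equiv.Perm (Fin r)) (i : Fin r) (p : Fin N) :
      (∑ j, Finsupp.single (v (π j, q j)) 1 : _ →₀ ℕ) (v (i, p)) =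
        if p = q (π⁻¹ i) then 1 else 0 := by
    rw [Finsupp.finsetSum_apply, Finset.sum_eq_single (π⁻¹ i)]
    · rw [show π (π⁻¹ i) = i from π.apply_symm_apply i, Finsupp.single_apply]
      simp [eq_comm]
    · intro j _ hj
      rw [Finsupp.single_apply, if_neg]
      intro h
      have h1 : π j = i := congrArg Prod.fst (v.injective h)
      exact hj (by rw [← h1]; exact (π.symm_apply_apply j).symm)
    · simp
  have happly1 (i : Fin r) (p : Fin N) :
      (∑ j, Finsupp.single (v (j, q j)) 1 : _ →₀ ℕ) (v (i, p)) = if p = q i then 1 else 0 :=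
    happly 1 i p
  have hsmall {i : Fin r} (hi : π⁻¹ i ≠ i) :
      (∑ j, Finsupp.single (v (π j, q j)) 1 : _ →₀ ℕ) (v (i, q i)) <
        (∑ j, Finsupp.single (v (j, q j)) 1 : _ →₀ ℕ) (v (i, q i)) := by
    rw [happly, happly1, if_pos rfl, if_neg fun h => hi (hq.injective h).symm]
    exact one_pos
  refine lexMonomialOrder_lt_of_forall_exists (fun heq => ?_) fun y hy => ?_
  · obtain ⟨i, hi⟩ : ∃ i, π⁻¹ i ≠ i := by
      by_contra! h
      exact hπ (inv_eq_one.1 (Equiv.ext h))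
    exact (hsmall hi).ne (DFunLike.congr_fun heq _)
  · obtain ⟨⟨i, p⟩, rfl⟩ := v.surjective y
    rw [happly, happly1] at hy
    by_cases hp : p = q i
    · rw [if_pos hp] at hy
      split_ifs at hy <;> omega
    have hp' : p = q (π⁻¹ i) := by
      by_contra h
      rw [if_neg h] at hy
      omega
    have hne : π⁻¹ i ≠ i := fun h => hp (by rw [hp', h])
    rcases hne.lt_or_gt with h | h
    · refine ⟨v (π⁻¹ i, q (π⁻¹ i)), ?_, hsmall fun h' => hne (π⁻¹.injective h')⟩
      rw [← hp']
      exact hrow _ _ _ h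
    · refine ⟨v (i, q i), hcol _ _ _ ?_, hsmall hne⟩
      rw [hp']
      exact hq h

variable (K r₀ r₁ : ℕ)

/-- The labels `(i, k)`, ordered lexicographically. -/
def labelEquiv (s : ℕ) : Fin (K * s) ≃ Fin K × Fin s := finProdFinEquiv.symm

variable {K} in
theorem toLex_labelEquiv_strictMono (s : ℕ) : StrictMono fun q => toLex (labelEquiv K s q) := by
  intro p q hpq
  rw [Prod.Lex.toLex_lt_toLex]
  have hp : (p : ℕ) % s + s * (p / s) = p := Nat.mod_add_div _ _
  have hq : (q : ℕ) % s + s * (q / s) = q := Nat.mod_add_div _ _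
  have hdiv : (p : ℕ) / s ≤ q / s := Nat.div_le_div_right hpq.le
  rcases hdiv.lt_or_eq with h | h
  · exact Or.inl h
  · refine Or.inr ⟨Fin.ext h, ?_⟩
    change (p : ℕ) % s < q % s
    rw [h] at hp
    rw [Fin.lt_def] at hpq
    omega

/-- The coordinates as entries of the `r₁ × K r₀` matrix `(M₁ | M₂ | ⋯)`. -/
def plusEquiv : Fin r₁ × Fin (K * r₀) ≃ Fin K × Fin r₁ × Fin r₀ :=
  (Equiv.prodCongr (Equiv.refl _) (labelEquiv K r₀)).trans
    ((Equiv.prodAssoc _ _ _).symm.trans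
      ((Equiv.prodCongr (Equiv.prodComm _ _) (Equiv.refl _)).trans (Equiv.prodAssoc _ _ _)))

/-- The coordinates as entries of the `r₀ × K r₁` matrix `(M₁ᵀ | M₂ᵀ | ⋯)`. -/
def minusEquiv : Fin r₀ × Fin (K * r₁) ≃ Fin K × Fin r₁ × Fin r₀ :=
  (Equiv.prodCongr (Equiv.refl _) (labelEquiv K r₁)).trans
    ((Equiv.prodComm _ _).trans (Equiv.prodAssoc _ _ _))

variable {K r₀ r₁}

theorem plusEquiv_apply (j : Fin r₁) (q : Fin (K * r₀)) :
    plusEquiv K r₀ r₁ (j, q) = ((labelEquiv K r₀ q).1, j, (labelEquiv K r₀ q).2) := rfl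

theorem minusEquiv_apply (k : Fin r₀) (q : Fin (K * r₁)) :
    minusEquiv K r₀ r₁ (k, q) = ((labelEquiv K r₁ q).1, (labelEquiv K r₁ q).2, k) := rfl

theorem plusEquiv_symm_apply (x : Fin K × Fin r₁ × Fin r₀) :
    (plusEquiv K r₀ r₁).symm x = (x.2.1, (labelEquiv K r₀).symm (x.1, x.2.2)) := rfl

theorem minusEquiv_symm_apply (x : Fin K × Fin r₁ × Fin r₀) :
    (minusEquiv K r₀ r₁).symm x = (x.2.2, (labelEquiv K r₁).symm (x.1, x.2.1)) := rfl

theorem isDiagonalOrder_plusEquiv :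
    IsDiagonalOrder (plusEquiv K r₀ r₁) (lexMonomialOrder K r₀ r₁) := by
  refine isDiagonalOrder_lexMonomialOrder _ (fun i j q h => ?_) fun j p q h => ?_
  · simp [lexVar_lt_iff, plusEquiv_apply, h]
  · have := toLex_labelEquiv_strictMono r₀ h
    rw [Prod.Lex.toLex_lt_toLex] at this
    simpa [lexVar_lt_iff, plusEquiv_apply] using this

theorem isDiagonalOrder_minusEquiv :
    IsDiagonalOrder (minusEquiv K r₀ r₁) (lexMonomialOrder K r₀ r₁) := by
  refine isDiagonalOrder_lexMonomialOrder _ (fun i j q h => ?_) fun j p q h => ?_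
  · simp [lexVar_lt_iff, minusEquiv_apply, h]
  · have := toLex_labelEquiv_strictMono r₁ h
    rw [Prod.Lex.toLex_lt_toLex] at this
    simpa [lexVar_lt_iff, minusEquiv_apply] using this

theorem leftMul_plusEquiv_X (h : Matrix (Fin r₁) (Fin r₁) ℂ) (x : Fin K × Fin r₁ × Fin r₀) :
    leftMul (plusEquiv K r₀ r₁) h (X x) = ∑ l, C (h x.2.1 l) * X (x.1, l, x.2.2) := by
  simp [leftMul, plusEquiv_symm_apply, plusEquiv_apply]

theorem leftMul_minusEquiv_X (h : Matrix (Fin r₀) (Fin r₀) ℂ) (x : Fin K × Fin r₁ × Fin r₀) :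
    leftMul (minusEquiv K r₀ r₁) h (X x) = ∑ l, C (h x.2.2 l) * X (x.1, x.2.1, l) := by
  simp [leftMul, minusEquiv_symm_apply, minusEquiv_apply]

/-- Right multiplication by g₀ is left multiplication of the transposed blocks by g₀ᵀ, so the two
group factors can be treated separately. -/
theorem act_eq_comp (g : GLGroup r₀ r₁) :
    act K g = (leftMul (plusEquiv K r₀ r₁) (g.2⁻¹).val).comp
      (leftMul (minusEquiv K r₀ r₁) g.1.val.transpose) := by
  refine MvPolynomial.algHom_ext fun x => ?_
  rw [AlgHom.comp_apply, leftMul_minusEquiv_X, map_sum, act, aeval_X, Matrix.mul_apply]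
  refine Finset.sum_congr rfl fun l _ => ?_
  rw [map_mul, leftMul_plusEquiv_X, Matrix.mul_apply, mul_comm, ← algebraMap_eq, AlgHom.commutes]
  rfl

theorem leftMul_one {r N : ℕ} {σ : Type*} (v : Fin r × Fin N ≃ σ) :
    leftMul v 1 = AlgHom.id ℂ _ := by
  refine MvPolynomial.algHom_ext fun x => ?_
  rw [leftMul, aeval_X, Finset.sum_eq_single (v.symm x).1]
  · simp
  · intro l _ hl
    rw [Matrix.one_apply_ne hl.symm, C_0, zero_mul]
  · simp

theorem leftMul_minorProd {r N w : ℕ} {σ : Type*} (v : Fin r × Fin N ≃ σ)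
    (g : Matrix (Fin r) (Fin r) ℂ) (s : Fin r × Fin w → Fin N) :
    leftMul v g (minorProd v s) = g.det ^ w • minorProd v s := by
  have h (q : Fin r → Fin N) : leftMul v g (minor v q) = C g.det * minor v q := by
    rw [minor, AlgHom.map_det, RingHom.map_det, ← Matrix.det_mul]
    congr 1
    ext1 a b
    simp [leftMul, Matrix.mul_apply]
  simp_rw [minorProd, map_prod, h, Finset.prod_mul_distrib, Finset.prod_const, Finset.card_univ,
    Fintype.card_fin, ← C_pow, smul_eq_C_mul]

/-- Semi-invariants of the Kronecker quiver are semi-invariants of `GL(r₁)`. -/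
theorem isDetSemiInvariant_plus {α : ℤ × ℤ} {f : CoordRing K r₀ r₁}
    (hf : f ∈ semiInvariants K r₀ r₁ α) : IsDetSemiInvariant (plusEquiv K r₀ r₁) (-α.2) f := by
  intro g hg
  let g' : Matrix.GeneralLinearGroup (Fin r₁) ℂ := Matrix.GeneralLinearGroup.mkOfDetNeZero g hg
  -- The action substitutes the inverse of the second component, hence `g⁻¹` here and the sign in
  -- the weight.
  have h := hf (1, g'⁻¹)
  rw [act_eq_comp] at h
  have hdet : (g'⁻¹ : Matrix.GeneralLinearGroup (Fin r₁) ℂ).val.det = g.det⁻¹ := by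
    rw [Matrix.coe_units_inv, Matrix.det_nonsing_inv, Ring.inverse_eq_inv']
    rfl
  simp only [inv_inv, Units.val_one, Matrix.transpose_one, leftMul_one, AlgHom.comp_id, character,
    Matrix.det_one, one_zpow, one_mul, hdet] at h
  rw [zpow_neg, ← inv_zpow]
  exact h

/-- Semi-invariants of the Kronecker quiver are semi-invariants of `GL(r₀)`. -/
theorem isDetSemiInvariant_minus {α : ℤ × ℤ} {f : CoordRing K r₀ r₁}
    (hf : f ∈ semiInvariants K r₀ r₁ α) : IsDetSemiInvariant (minusEquiv K r₀ r₁) α.1 f := by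
  intro g hg
  rw [← Matrix.det_transpose] at hg ⊢
  have h := hf (Matrix.GeneralLinearGroup.mkOfDetNeZero _ hg, 1)
  rw [act_eq_comp] at h
  simp only [inv_one, Units.val_one, leftMul_one, AlgHom.id_comp, character, Matrix.det_one,
    one_zpow, mul_one] at h
  exact h

theorem mem_semiInvariants_of_leftMul {m n : ℕ} {f : CoordRing K r₀ r₁}
    (hp : ∀ g, leftMul (plusEquiv K r₀ r₁) g f = g.det ^ n • f)
    (hm : ∀ g, leftMul (minusEquiv K r₀ r₁) g f = g.det ^ m • f) :
    f ∈ semiInvariants K r₀ r₁ ((m : ℤ), -(n : ℤ)) := by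
  intro g
  rw [act_eq_comp, AlgHom.comp_apply, hm, map_smul, hp, smul_smul, character,
    Matrix.det_transpose, Matrix.coe_units_inv, Matrix.det_nonsing_inv, Ring.inverse_eq_inv',
    zpow_natCast, zpow_neg, zpow_natCast, inv_pow]

end Coordinates

/-! ### The polynomials of linked pairs -/

/-- Between equal arrows the arrow is constant along a strictly increasing column, so the second
entry grows by at least one per row. -/
theorem strictMono_label_gap {K r s : ℕ} {t : Fin r → Fin K × Fin s}
    (ht : StrictMono fun j => toLex (t j)) {a b : Fin r} (hab : a ≤ b) (hi : (t a).1 = (t b).1) :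
    ((t a).2 : ℕ) + b ≤ (t b).2 + a := by
  obtain ⟨b, hb⟩ := b
  induction b with
  | zero =>
    obtain rfl : a = ⟨0, hb⟩ := Fin.ext (Nat.le_zero.1 hab)
    exact le_rfl
  | succ b ih =>
    rcases hab.lt_or_eq with hlt | rfl
    · have hle : a ≤ ⟨b, by omega⟩ := Nat.le_of_lt_succ hlt
      have h1 := ht.monotone hle
      have h2 : toLex (t ⟨b, by omega⟩) < toLex (t ⟨b + 1, hb⟩) := ht (by simp [Fin.lt_def])
      rw [Prod.Lex.toLex_le_toLex] at h1
      rw [Prod.Lex.toLex_lt_toLex] at h2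
      have h3 := ih (by omega) hle
      simp only [Fin.lt_def, Fin.le_def, Fin.ext_iff] at *
      omega
    · exact le_rfl

namespace LinkedPair

open MvPolynomial

variable {K r₀ r₁ : ℕ} (T : LinkedPair K r₀ r₁)

/-- The variable of a box of `tPlus`. -/
def boxVar (b : Fin r₁ × Fin T.wPlus) : Fin K × Fin r₁ × Fin r₀ :=
  ((T.tPlus b.1 b.2).1, b.1, (T.tPlus b.1 b.2).2)

/-- The variable of a box of `tPlus` after the action of column permutations. -/
def movedVar (am : Fin T.wMinus → Equiv.Perm (Fin r₀)) (ap : Fin T.wPlus → Equiv.Perm (Fin r₁))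
    (b : Fin r₁ × Fin T.wPlus) : Fin K × Fin r₁ × Fin r₀ :=
  ((T.tPlus b.1 b.2).1, ap b.2 b.1, am (T.link b).2 (T.tPlus b.1 b.2).2)

theorem prod_X_eq_monomial {E V : Type*} [Fintype E] (L : E → V) :
    ∏ e, (X (L e) : MvPolynomial V ℂ) = monomial (labelDegree L) 1 := by
  rw [labelDegree, monomial_sum_one]
  rfl

/-- Reindexing each column by its permutation follows every box from its original position. -/
theorem mon_actMinus_actPlus (am : Fin T.wMinus → Equiv.Perm (Fin r₀))
    (ap : Fin T.wPlus → Equiv.Perm (Fin r₁)) :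
    ((T.actPlus ap).actMinus am).mon = ∏ b, X (T.movedVar am ap b) := by
  rw [mon, Fintype.prod_prod_type_right, Finset.prod_comm]
  refine Finset.prod_congr rfl fun c _ => ?_
  refine Fintype.prod_equiv (ap c)⁻¹ _ _ fun j => ?_
  rw [movedVar]
  have : ap c ((ap c)⁻¹ j) = j := (ap c).apply_symm_apply j
  dsimp only
  rw [this]
  rfl

theorem semiInvariant_eq :
    T.semiInvariant = ∑ am : Fin T.wMinus → Equiv.Perm (Fin r₀),
      ∑ ap : Fin T.wPlus → Equiv.Perm (Fin r₁),
        ((∏ d, (Equiv.Perm.sign (am d) : ℤ)) * ∏ c, (Equiv.Perm.sign (ap c) : ℤ)) •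
          ∏ b, X (T.movedVar am ap b) := by
  simp_rw [semiInvariant, mon_actMinus_actPlus]

/-- For fixed `am`, the sum over `ap` is the Leibniz expansion of a product of minors of (M₁ | M₂ |
⋯), which makes the GL(r₁)-weight visible. -/
theorem semiInvariant_eq_sum_plus :
    T.semiInvariant = ∑ am : Fin T.wMinus → Equiv.Perm (Fin r₀),
      (∏ d, (Equiv.Perm.sign (am d) : ℤ)) • minorProd (plusEquiv K r₀ r₁)
        fun b => (labelEquiv K r₀).symm
          ((T.tPlus b.1 b.2).1, am (T.link b).2 (T.tPlus b.1 b.2).2) := by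
  rw [semiInvariant_eq]
  refine Finset.sum_congr rfl fun am _ => ?_
  rw [minorProd_eq_sum, Finset.smul_sum]
  refine Finset.sum_congr rfl fun ap _ => ?_
  rw [smul_smul]
  simp only [plusEquiv_apply, Equiv.apply_symm_apply, movedVar]

/-- The same for the transposed blocks and GL(r₀), after carrying the product over to the boxes of
`tMinus` along the link. -/
theorem semiInvariant_eq_sum_minus :
    T.semiInvariant = ∑ ap : Fin T.wPlus → Equiv.Perm (Fin r₁),
      (∏ c, (Equiv.Perm.sign (ap c) : ℤ)) • minorProd (minusEquiv K r₀ r₁)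
        fun b => (labelEquiv K r₁).symm
          ((T.tMinus b.1 b.2).1, ap (T.link.symm b).2 (T.tMinus b.1 b.2).2) := by
  rw [semiInvariant_eq, Finset.sum_comm]
  refine Finset.sum_congr rfl fun ap _ => ?_
  rw [minorProd_eq_sum, Finset.smul_sum]
  refine Finset.sum_congr rfl fun am _ => ?_
  rw [smul_smul, mul_comm]
  congr 1
  refine Fintype.prod_equiv T.link _ _ fun b => ?_
  simp only [minusEquiv_apply, Equiv.apply_symm_apply, movedVar, Equiv.symm_apply_apply]
  rw [T.link_arrow, T.link_row_plus, T.link_row_minus]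

theorem semiInvariant_mem :
    T.semiInvariant ∈ semiInvariants K r₀ r₁ ((T.wMinus : ℤ), -(T.wPlus : ℤ)) := by
  refine mem_semiInvariants_of_leftMul (fun g => ?_) fun g => ?_
  · simp_rw [semiInvariant_eq_sum_plus, map_sum, map_zsmul, leftMul_minorProd, Finset.smul_sum]
    exact Finset.sum_congr rfl fun _ _ => smul_comm _ _ _
  · simp_rw [semiInvariant_eq_sum_minus, map_sum, map_zsmul, leftMul_minorProd, Finset.smul_sum]
    exact Finset.sum_congr rfl fun _ _ => smul_comm _ _ _

theorem semiInvariant_mem_semiInvariantRing : T.semiInvariant ∈ semiInvariantRing K r₀ r₁ :=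
  Submodule.mem_iSup_of_mem _ T.semiInvariant_mem

variable {T}

/-- Each box of `tPlus` is an edge from its column to the column of its linked box. Column
permutations change the indices only within a vertex, and strictness of both tableaux along columns
gives the monotonicity. -/
theorem IsSemiStandard.isRelabelling (hT : T.IsSemiStandard)
    (am : Fin T.wMinus → Equiv.Perm (Fin r₀)) (ap : Fin T.wPlus → Equiv.Perm (Fin r₁)) :
    IsRelabelling (fun b : Fin r₁ × Fin T.wPlus => b.2) (fun b => (T.link b).2) T.boxVar
      (T.movedVar am ap) where
  color _ := rfl
  inj_left := by
    rintro ⟨j, c⟩ ⟨j', c'⟩ hc h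
    obtain rfl : c = c' := hc
    exact Prod.ext ((ap c).injective h) rfl
  inj_right b b' hd h := T.link.injective <| Prod.ext (by
    rw [T.link_row_minus, T.link_row_minus]
    dsimp only [movedVar] at h hd
    rw [hd] at h
    exact (am _).injective h) hd
  inj_left' _ _ hc h := Prod.ext h hc
  inj_right' b b' hd h := T.link.injective <| Prod.ext (by
    rw [T.link_row_minus, T.link_row_minus]
    exact h) hd
  exists_left b := ⟨(ap b.2 b.1, b.2), rfl, rfl⟩
  exists_right b := ⟨T.link.symm (am (T.link b).2 (T.tPlus b.1 b.2).2, (T.link b).2), by simp, by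
    rw [boxVar, ← T.link_row_minus, Equiv.apply_symm_apply]
    rfl⟩
  color_left := by
    rintro ⟨j, c⟩ ⟨j', c'⟩ hc h
    obtain rfl : c = c' := hc
    have := hT.2.1.2 c h
    rw [Prod.Lex.toLex_lt_toLex] at this
    rcases this with h | h
    exacts [h.le, h.1.le]
  color_right := by
    intro b b' hd h
    have h' : (T.link b).1 < (T.link b').1 := by
      rw [T.link_row_minus, T.link_row_minus]
      exact h
    have := hT.1.2 (T.link b).2 h'
    dsimp only at this hd
    rw [Prod.Lex.toLex_lt_toLex, T.link_arrow, hd, T.link_arrow] at this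
    rcases this with h | h
    exacts [h.le, h.1.le]
  strict_left := by
    rintro ⟨j, c⟩ ⟨j', c'⟩ hc hi h
    obtain rfl : c = c' := hc
    exact strictMono_label_gap (hT.2.1.2 c) h hi
  strict_right := by
    intro b b' hd hi h
    have h1 : (T.link b).1 ≤ (T.link b').1 := by
      rw [T.link_row_minus, T.link_row_minus]
      exact h
    have h2 := strictMono_label_gap (hT.1.2 (T.link b).2) h1 (by
      rw [T.link_arrow, hd, T.link_arrow]
      exact hi)
    rw [T.link_row_plus, hd, T.link_row_plus, T.link_row_minus, T.link_row_minus] at h2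
    exact h2

/-- Transported along the link, `am` becomes the same permutation of the boxes as `ap`, so the two
signs agree. The semi-standard link is what keeps equally labelled edges from crossing. -/
theorem IsSemiStandard.sign_eq (hT : T.IsSemiStandard) {am : Fin T.wMinus → Equiv.Perm (Fin r₀)}
    {ap : Fin T.wPlus → Equiv.Perm (Fin r₁)}
    (h : labelDegree (T.movedVar am ap) = labelDegree T.boxVar) :
    (∏ d, (Equiv.Perm.sign (am d) : ℤ)) * ∏ c, (Equiv.Perm.sign (ap c) : ℤ) = 1 := by
  have hperm := (hT.isRelabelling am ap).perm_eq_of_labelDegree_eq (fun b b' hb hlt => ?_) h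
    (Equiv.prodCongrLeft ap) (T.link.symm.permCongr (Equiv.prodCongrLeft am))
    (fun b => ⟨rfl, rfl⟩) (fun b => ⟨by simp [Equiv.permCongr_apply], ?_⟩)
  · have hsign := congrArg Equiv.Perm.sign hperm
    rw [Equiv.Perm.sign_permCongr, Equiv.Perm.sign_prodCongrLeft,
      Equiv.Perm.sign_prodCongrLeft] at hsign
    simp only [← Units.coe_prod]
    rw [← hsign, ← Units.val_mul, Int.units_mul_self, Units.val_one]
  · obtain ⟨j, c⟩ := b
    obtain ⟨j', c'⟩ := b'
    simp only [boxVar, Prod.mk.injEq] at hb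
    obtain ⟨h1, rfl, h2⟩ := hb
    exact hT.2.2 j c c' (Prod.ext h1 h2) hlt
  · rw [boxVar, ← T.link_row_minus]
    simp [Equiv.permCongr_apply, movedVar, T.link_row_minus]

/-- Each term with this monomial counts +1, and the identity permutations give one. -/
theorem IsSemiStandard.coeff_semiInvariant_ne_zero (hT : T.IsSemiStandard) :
    coeff (labelDegree T.boxVar) T.semiInvariant ≠ 0 := by
  classical
  have hterm (am ap) : coeff (labelDegree T.boxVar)
      (((∏ d, (Equiv.Perm.sign (am d) : ℤ)) * ∏ c, (Equiv.Perm.sign (ap c) : ℤ)) •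
          ∏ b, X (T.movedVar am ap b) : CoordRing K r₀ r₁) =
      ((if labelDegree (T.movedVar am ap) = labelDegree T.boxVar then 1 else 0 : ℕ) : ℂ) := by
    rw [prod_X_eq_monomial, zsmul_eq_mul, ← map_intCast (C : ℂ →+* CoordRing K r₀ r₁),
      coeff_C_mul, coeff_monomial]
    split_ifs with h
    · rw [hT.sign_eq h]
      simp
    · simp
  rw [semiInvariant_eq]
  simp_rw [coeff_sum, hterm, ← Nat.cast_sum]
  rw [Nat.cast_ne_zero, ← Nat.pos_iff_ne_zero]
  refine Finset.sum_pos' (fun _ _ => Nat.zero_le _) ⟨fun _ => 1, Finset.mem_univ _, ?_⟩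
  refine Finset.sum_pos' (fun _ _ => Nat.zero_le _) ⟨fun _ => 1, Finset.mem_univ _, ?_⟩
  have : labelDegree (T.movedVar (fun _ => 1) fun _ => 1) = labelDegree T.boxVar := rfl
  rw [if_pos this]
  exact one_pos

theorem IsSemiStandard.semiInvariant_ne_zero (hT : T.IsSemiStandard) : T.semiInvariant ≠ 0 :=
  fun h => hT.coeff_semiInvariant_ne_zero (by rw [h, coeff_zero])

/-- The leading monomial of `f_T` is the monomial of `T`. -/
theorem IsSemiStandard.degree_semiInvariant (hT : T.IsSemiStandard) :
    (lexMonomialOrder K r₀ r₁).degree T.semiInvariant = labelDegree T.boxVar := by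
  classical
  refine (lexMonomialOrder K r₀ r₁).toSyn.injective (le_antisymm
    (MonomialOrder.degree_le_iff.2 fun b hb => ?_)
    (MonomialOrder.le_degree (mem_support_iff.2 hT.coeff_semiInvariant_ne_zero)))
  rw [mem_support_iff, semiInvariant_eq, coeff_sum] at hb
  obtain ⟨am, -, hb⟩ := Finset.exists_ne_zero_of_sum_ne_zero hb
  rw [coeff_sum] at hb
  obtain ⟨ap, -, hb⟩ := Finset.exists_ne_zero_of_sum_ne_zero hb
  rw [prod_X_eq_monomial, zsmul_eq_mul, ← map_intCast (C : ℂ →+* CoordRing K r₀ r₁),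
    coeff_C_mul, coeff_monomial] at hb
  rw [← (ite_ne_right_iff.1 (right_ne_zero_of_mul hb)).1]
  exact (hT.isRelabelling am ap).labelDegree_le

end LinkedPair

/-! ### Existence and uniqueness of semi-standard links -/

namespace LinkedPair

variable {K r₀ r₁ : ℕ}

/-- Two finite sets of the same size in linear orders are in increasing bijection. -/
theorem exists_equiv_lt_of_card_eq {A B α β : Type*} [Fintype A] [Fintype B] [LinearOrder α]
    [LinearOrder β] (κ : A → α) (hκ : Function.Injective κ) (μ : B → β)
    (hμ : Function.Injective μ) (h : Fintype.card A = Fintype.card B) :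
    ∃ e : A ≃ B, ∀ a a', κ a < κ a' → μ (e a) < μ (e a') := by
  let _ : LinearOrder A := LinearOrder.lift' κ hκ
  let _ : LinearOrder B := LinearOrder.lift' μ hμ
  let e : A ≃o B := (Fintype.orderIsoFinOfCardEq A h).symm.trans (Fintype.orderIsoFinOfCardEq B rfl)
  exact ⟨e.toEquiv, fun a a' haa => e.strictMono haa⟩

/-- Two semi-standard tableaux with matching labels are linked in a semi-standard way. -/
theorem exists_of_labelDegree_eq {wm wp : ℕ} {tm : Fin r₀ → Fin wm → Fin K × Fin r₁}
    {tp : Fin r₁ → Fin wp → Fin K × Fin r₀} (hm : IsSemiStandardTableau tm)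
    (hp : IsSemiStandardTableau tp)
    (h : labelDegree (fun b : Fin r₁ × Fin wp => ((tp b.1 b.2).1, b.1, (tp b.1 b.2).2)) =
      labelDegree fun b : Fin r₀ × Fin wm => ((tm b.1 b.2).1, (tm b.1 b.2).2, b.1)) :
    ∃ T : LinkedPair K r₀ r₁, T.IsSemiStandard ∧ T.wMinus = wm ∧ T.wPlus = wp ∧
      labelDegree T.boxVar =
        labelDegree fun b : Fin r₁ × Fin wp => ((tp b.1 b.2).1, b.1, (tp b.1 b.2).2) := by
  classical
  let lp : Fin r₁ × Fin wp → Fin K × Fin r₁ × Fin r₀ := fun b =>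
    ((tp b.1 b.2).1, b.1, (tp b.1 b.2).2)
  let lm : Fin r₀ × Fin wm → Fin K × Fin r₁ × Fin r₀ := fun b =>
    ((tm b.1 b.2).1, (tm b.1 b.2).2, b.1)
  -- Boxes with the same variable are equally many in both tableaux, lie in one row of each, and are
  -- matched from left to right.
  have hex (x) : ∃ e : {b // lp b = x} ≃ {b // lm b = x},
      ∀ a a', a.1.2 < a'.1.2 → (e a).1.2 < (e a').1.2 := by
    refine exists_equiv_lt_of_card_eq (fun a : {b // lp b = x} => a.1.2) (fun a a' haa => ?_)
      (fun b : {b // lm b = x} => b.1.2) (fun b b' hbb => ?_) ?_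
    · have := a.2.trans a'.2.symm
      simp only [lp, Prod.mk.injEq] at this
      exact Subtype.ext (Prod.ext this.2.1 haa)
    · have := b.2.trans b'.2.symm
      simp only [lm, Prod.mk.injEq] at this
      exact Subtype.ext (Prod.ext this.2.2 hbb)
    · rw [Fintype.card_subtype, Fintype.card_subtype, ← labelDegree_apply, ← labelDegree_apply, h]
  choose e he using hex
  let link : Fin r₁ × Fin wp ≃ Fin r₀ × Fin wm := (Equiv.sigmaFiberEquiv lp).symm.trans
    ((Equiv.sigmaCongrRight e).trans (Equiv.sigmaFiberEquiv lm))
  have hlink (b) : lm (link b) = lp b := (e (lp b) ⟨b, rfl⟩).2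
  have hlink' {x} {b} (hb : lp b = x) : link b = (e x ⟨b, hb⟩).1 := by
    subst hb
    rfl
  have hlink1 (b) := congrArg Prod.fst (hlink b)
  have hlink2 (b) := congrArg (fun x => x.2.1) (hlink b)
  have hlink3 (b) := congrArg (fun x => x.2.2) (hlink b)
  refine ⟨⟨wm, wp, tm, tp, link, hlink1, hlink3, hlink2⟩, ⟨hm, hp, fun j c c' hc hlt => ?_⟩, rfl,
    rfl, rfl⟩
  have h1 : lp (j, c) = (((tp j c).1, j, (tp j c).2) : Fin K × Fin r₁ × Fin r₀) := rfl
  have h2 : lp (j, c') = (((tp j c).1, j, (tp j c).2) : Fin K × Fin r₁ × Fin r₀) := by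
    dsimp only at hc
    rw [hc]
  change (link (j, c)).2 < (link (j, c')).2
  rw [hlink' h1, hlink' h2]
  exact he _ _ _ hlt

theorem labelDegree_boxVar_eq (T : LinkedPair K r₀ r₁) :
    labelDegree T.boxVar = labelDegree fun b : Fin r₀ × Fin T.wMinus =>
      ((T.tMinus b.1 b.2).1, (T.tMinus b.1 b.2).2, b.1) := by
  refine Fintype.sum_equiv T.link _ _ fun b => ?_
  dsimp only
  rw [T.link_arrow, T.link_row_plus, T.link_row_minus, boxVar]

theorem degree_labelDegree {E V : Type*} [Fintype E] (L : E → V) :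
    (labelDegree L).degree = Fintype.card E := by
  simp [labelDegree, map_sum]

theorem tableau_eq_of_card_eq {r s w : ℕ} {t t' : Fin r → Fin w → Fin K × Fin s}
    (ht : IsSemiStandardTableau t) (ht' : IsSemiStandardTableau t')
    (h : ∀ j q, (Finset.univ.filter fun c => t j c = q).card =
      (Finset.univ.filter fun c => t' j c = q).card) : t = t' := by
  ext1 j
  have := monotone_eq_of_card_eq (ht.1 j) (ht'.1 j) fun q => by
    simpa only [← ofLex_inj, ofLex_toLex] using h j (ofLex q)
  ext1 c
  exact toLex_inj.1 (congrFun this c)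

/-- A semi-standard linked pair is determined by its monomial. -/
theorem IsSemiStandard.eq_of_labelDegree_eq (hr₀ : 0 < r₀) (hr₁ : 0 < r₁)
    {T T' : LinkedPair K r₀ r₁} (hT : T.IsSemiStandard) (hT' : T'.IsSemiStandard)
    (h : labelDegree T.boxVar = labelDegree T'.boxVar) : T = T' := by
  classical
  have hm := T.labelDegree_boxVar_eq.symm.trans (h.trans T'.labelDegree_boxVar_eq)
  obtain ⟨wm, wp, tm, tp, link, h1, h2, h3⟩ := T
  obtain ⟨wm', wp', tm', tp', link', h1', h2', h3'⟩ := T'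
  -- The total degree is `r₁ * wPlus`, and also `r₀ * wMinus`; positivity of the ranks recovers the
  -- widths.
  obtain rfl : wp = wp' := by
    have := congrArg Finsupp.degree h
    rw [degree_labelDegree, degree_labelDegree] at this
    simpa [hr₁.ne'] using this
  obtain rfl : wm = wm' := by
    have := congrArg Finsupp.degree hm
    rw [degree_labelDegree, degree_labelDegree] at this
    simpa [hr₀.ne'] using this
  have hcount {n w : ℕ} {V W : Type} [DecidableEq V] [DecidableEq W] (t : Fin n → Fin w → V)
      (ι : Fin n → V → W) (hι : ∀ j q j' q', ι j q = ι j' q' ↔ j = j' ∧ q = q') (j : Fin n)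
      (q : V) : labelDegree (fun b : Fin n × Fin w => ι b.1 (t b.1 b.2)) (ι j q) =
        (Finset.univ.filter fun c => t j c = q).card := by
    rw [labelDegree_apply, Finset.card_filter, Finset.card_filter, Fintype.sum_prod_type,
      Finset.sum_eq_single j]
    · simp [hι]
    · intro i _ hi
      simp [hι, hi]
    · simp
  obtain rfl : tp = tp' := tableau_eq_of_card_eq hT.2.1 hT'.2.1 fun j q => by
    have hι : ∀ (j : Fin r₁) (q : Fin K × Fin r₀) j' q',
        ((q.1, j, q.2) : Fin K × Fin r₁ × Fin r₀) = (q'.1, j', q'.2) ↔ j = j' ∧ q = q' := by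
      intro j q j' q'
      simp only [Prod.ext_iff]
      tauto
    rw [← hcount tp (fun j q => (q.1, j, q.2)) hι, ← hcount tp' (fun j q => (q.1, j, q.2)) hι]
    exact DFunLike.congr_fun h _
  obtain rfl : tm = tm' := tableau_eq_of_card_eq hT.1 hT'.1 fun k q => by
    have hι : ∀ (k : Fin r₀) (q : Fin K × Fin r₁) k' q',
        ((q.1, q.2, k) : Fin K × Fin r₁ × Fin r₀) = (q'.1, q'.2, k') ↔ k = k' ∧ q = q' := by
      intro k q k' q'
      simp only [Prod.ext_iff]
      tauto
    rw [← hcount tm (fun k q => (q.1, q.2, k)) hι, ← hcount tm' (fun k q => (q.1, q.2, k)) hι]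
    exact DFunLike.congr_fun hm _
  obtain rfl : link = link' := by
    -- `ρ` measures the difference of the links. It preserves the variable of each box and, both
    -- links being semi-standard, the left-to-right order among boxes with equal variable; so it is
    -- trivial.
    let ρ : Equiv.Perm (Fin r₁ × Fin wp) := link.trans link'.symm
    let l : Fin r₁ × Fin wp → Fin K ×ₗ (Fin r₁ ×ₗ Fin r₀) := fun b =>
      lexVar K r₀ r₁ ((tp b.1 b.2).1, b.1, (tp b.1 b.2).2)
    have hl {b b'} : l b = l b' ↔ b.1 = b'.1 ∧ tp b.1 b.2 = tp b'.1 b'.2 := by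
      simp only [l, EmbeddingLike.apply_eq_iff_eq, Prod.ext_iff]
      tauto
    have hlinkρ (b) : link' (ρ b) = link b := link'.apply_symm_apply _
    have hρl (b) : l (ρ b) = l b := by
      have e1 := h1' (ρ b)
      have e2 := h2' (ρ b)
      have e3 := h3' (ρ b)
      rw [hlinkρ] at e1 e2 e3
      exact hl.2 ⟨e3.symm.trans (h3 b), Prod.ext (e1.symm.trans (h1 b)) (e2.symm.trans (h2 b))⟩
    have hρ : ρ = 1 := by
      refine perm_eq_one_of_lt (fun b => toLex (l b, b.2)) (fun b b' hbb => ?_) ρ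
        fun b b' hlt => ?_
      · have hbb' := toLex.injective hbb
        exact Prod.ext (hl.1 (Prod.ext_iff.1 hbb').1).1 (Prod.ext_iff.1 hbb').2
      · rw [Prod.Lex.toLex_lt_toLex] at hlt ⊢
        dsimp only at hlt ⊢
        rw [hρl, hρl]
        refine hlt.imp_right fun ⟨heq, hc⟩ => ⟨heq, ?_⟩
        obtain ⟨j, c⟩ := b
        obtain ⟨j', c'⟩ := b'
        obtain ⟨rfl, htp⟩ : j = j' ∧ tp j c = tp j' c' := hl.1 heq
        have hlt1 := hT.2.2 j c c' htp hc
        dsimp only at hlt1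
        rw [← hlinkρ, ← hlinkρ] at hlt1
        obtain ⟨hrow, htp'⟩ := hl.1 ((hρl _).trans (heq.trans (hρl _).symm))
        by_contra hnot
        rcases (not_lt.1 hnot).lt_or_eq with hgt | hceq
        · have h4 := hT'.2.2 (ρ (j, c')).1 (ρ (j, c')).2 (ρ (j, c)).2 (by
            dsimp only
            rw [← htp', hrow]) hgt
          dsimp only at h4
          rw [Prod.mk.eta, ← hrow, Prod.mk.eta] at h4
          exact lt_asymm hlt1 h4
        · rw [Prod.ext hrow hceq.symm] at hlt1
          exact lt_irrefl _ hlt1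
    ext1 b
    rw [← hlinkρ b, hρ]
    rfl
  rfl

/-! ### Spanning and linear independence -/

open MvPolynomial

/-- The leading monomial of a semi-invariant is the monomial of a semi-standard linked pair. -/
theorem exists_degree_eq (hr₀ : 0 < r₀) (hr₁ : 0 < r₁) {α : ℤ × ℤ} {f : CoordRing K r₀ r₁}
    (hf : f ∈ semiInvariants K r₀ r₁ α) (hf0 : f ≠ 0) :
    ∃ T : LinkedPair K r₀ r₁, T.IsSemiStandard ∧ α = ((T.wMinus : ℤ), -(T.wPlus : ℤ)) ∧
      (lexMonomialOrder K r₀ r₁).degree f = labelDegree T.boxVar := by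
  obtain ⟨wp, hwp, tp, htp, hdp⟩ :=
    (isDetSemiInvariant_plus hf).exists_degree_eq isDiagonalOrder_plusEquiv hr₁ hf0
  obtain ⟨wm, hwm, tm, htm, hdm⟩ :=
    (isDetSemiInvariant_minus hf).exists_degree_eq isDiagonalOrder_minusEquiv hr₀ hf0
  have hp : IsSemiStandardTableau fun j c => labelEquiv K r₀ (tp (j, c)) :=
    ⟨fun j => (toLex_labelEquiv_strictMono r₀).monotone.comp (htp.1 j),
      fun c => (toLex_labelEquiv_strictMono r₀).comp (htp.2 c)⟩
  have hm : IsSemiStandardTableau fun k d => labelEquiv K r₁ (tm (k, d)) :=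
    ⟨fun k => (toLex_labelEquiv_strictMono r₁).monotone.comp (htm.1 k),
      fun d => (toLex_labelEquiv_strictMono r₁).comp (htm.2 d)⟩
  -- Both tableaux describe the leading monomial of the same f, so their labels match.
  obtain ⟨T, hT, rfl, rfl, hdeg⟩ := exists_of_labelDegree_eq hm hp (hdp.symm.trans hdm)
  exact ⟨T, hT, Prod.ext hwm.symm (by simp only; omega), hdp.trans hdeg.symm⟩

/-- Descent: subtracting a multiple of the f_T with the same leading monomial leaves a
semi-invariant of the same weight that is zero or has a smaller leading monomial, and the monomial
order is well-founded. -/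
theorem mem_span_of_mem_semiInvariants (hr₀ : 0 < r₀) (hr₁ : 0 < r₁) {α : ℤ × ℤ}
    {f : CoordRing K r₀ r₁} (hf : f ∈ semiInvariants K r₀ r₁ α) :
    f ∈ Submodule.span ℂ (Set.range fun T : {T : LinkedPair K r₀ r₁ // T.IsSemiStandard} =>
      T.1.semiInvariant) := by
  let mo := lexMonomialOrder K r₀ r₁
  induction hn : mo.toSyn (mo.degree f) using WellFoundedLT.induction generalizing f with
  | _ n ih =>
    subst hn
    by_cases hf0 : f = 0
    · rw [hf0]
      exact Submodule.zero_mem _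
    obtain ⟨T, hT, rfl, hdeg⟩ := exists_degree_eq hr₀ hr₁ hf hf0
    have hTdeg : mo.degree T.semiInvariant = mo.degree f := hT.degree_semiInvariant.trans hdeg.symm
    let a : ℂ := mo.leadingCoeff f / mo.leadingCoeff T.semiInvariant
    have hTspan : T.semiInvariant ∈ Submodule.span ℂ
        (Set.range fun T : {T : LinkedPair K r₀ r₁ // T.IsSemiStandard} => T.1.semiInvariant) :=
      Submodule.subset_span ⟨⟨T, hT⟩, rfl⟩
    have hcoeff : coeff (mo.degree f) (f - a • T.semiInvariant) = 0 := by
      rw [coeff_sub, coeff_smul, ← hTdeg, smul_eq_mul]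
      change coeff (mo.degree T.semiInvariant) f - a * mo.leadingCoeff T.semiInvariant = 0
      rw [div_mul_cancel₀ _ (mo.leadingCoeff_ne_zero_iff.2 hT.semiInvariant_ne_zero), hTdeg]
      exact sub_self _
    have hmem : f - a • T.semiInvariant ∈ Submodule.span ℂ
        (Set.range fun T : {T : LinkedPair K r₀ r₁ // T.IsSemiStandard} => T.1.semiInvariant) := by
      by_cases h0 : f - a • T.semiInvariant = 0
      · rw [h0]
        exact Submodule.zero_mem _
      refine ih _ (lt_of_le_of_ne ?_ fun heq => ?_)
        (Submodule.sub_mem _ hf (Submodule.smul_mem _ _ T.semiInvariant_mem)) rfl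
      · rw [MonomialOrder.degree_le_iff]
        intro b hb
        rw [mem_support_iff, coeff_sub, coeff_smul] at hb
        by_cases hfb : coeff b f = 0
        · rw [hfb, zero_sub, smul_eq_mul] at hb
          rw [← hTdeg]
          exact mo.le_degree (mem_support_iff.2 (right_ne_zero_of_mul (neg_ne_zero.1 hb)))
        · exact mo.le_degree (mem_support_iff.2 hfb)
      · rw [← mo.toSyn.injective heq] at hcoeff
        exact mo.coeff_degree_ne_zero_iff.2 h0 hcoeff
    have := Submodule.add_mem _ hmem (Submodule.smul_mem _ a hTspan)
    rwa [sub_add_cancel] at this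

/-- The leading monomials are pairwise distinct, because a semi-standard pair is determined by its
monomial. -/
theorem linearIndependent_semiInvariant (hr₀ : 0 < r₀) (hr₁ : 0 < r₁) :
    LinearIndependent ℂ fun T : {T : LinkedPair K r₀ r₁ // T.IsSemiStandard} =>
      T.1.semiInvariant := by
  rw [linearIndependent_iff']
  intro S a hsum
  by_contra! hne
  obtain ⟨T, -, -, h⟩ := exists_degree_sum_eq (lexMonomialOrder K r₀ r₁) S
    (fun T : {T : LinkedPair K r₀ r₁ // T.IsSemiStandard} => T.1.semiInvariant) a
    (fun T _ => T.2.semiInvariant_ne_zero)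
    (fun T _ T' _ h => Subtype.ext (T.2.eq_of_labelDegree_eq hr₀ hr₁ T'.2 (by
      simpa only [T.2.degree_semiInvariant, T'.2.degree_semiInvariant] using h))) hne
  exact h hsum

end LinkedPair

end KroneckerQuiver

end

theorem mainTheorem3 (K r₀ r₁ : ℕ) (hr₀ : 0 < r₀) (hr₁ : 0 < r₁) :
    ∃ b : Module.Basis {T : KroneckerQuiver.LinkedPair K r₀ r₁ // T.IsSemiStandard} ℂ
        (KroneckerQuiver.semiInvariantRing K r₀ r₁),
      ∀ T, (b T : KroneckerQuiver.CoordRing K r₀ r₁) = T.1.semiInvariant := by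
  let φ := (KroneckerQuiver.semiInvariantRing K r₀ r₁).val.toLinearMap
  let f : {T : KroneckerQuiver.LinkedPair K r₀ r₁ // T.IsSemiStandard} →
      KroneckerQuiver.semiInvariantRing K r₀ r₁ := fun T =>
    ⟨T.1.semiInvariant, T.1.semiInvariant_mem_semiInvariantRing⟩
  have hli : LinearIndependent ℂ f := LinearIndependent.of_comp φ
    (KroneckerQuiver.LinkedPair.linearIndependent_semiInvariant hr₀ hr₁)
  have hspan : ⊤ ≤ Submodule.span ℂ (Set.range f) := by
    rintro ⟨p, hp⟩ -
    -- The ring is the sum of the weight spaces, so spanning may be checked in each weight.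
    have hle : ⨆ α, KroneckerQuiver.semiInvariants K r₀ r₁ α ≤
        (Submodule.span ℂ (Set.range f)).map φ := by
      refine iSup_le fun α q hq => ?_
      rw [Submodule.map_span, ← Set.range_comp]
      exact KroneckerQuiver.LinkedPair.mem_span_of_mem_semiInvariants hr₀ hr₁ hq
    obtain ⟨q, hq, rfl⟩ := hle hp
    exact hq
  exact ⟨Module.Basis.mk hli hspan, fun T => by rw [Module.Basis.mk_apply]⟩
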